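/- **Circuits.** A probabilistic circuit (PC) $\mathscr{A}$ over variables $\mathbf X=\{X_1,\dots,X_n\}$ is a finite rooted DAG of sum, product and leaf nodes. A leaf computes a univariate probability density of one variable (with respect to a fixed reference measure for that variable), a product node the product of its children, and a sum node $t$ the mixture $\sum_c w_{t,c}\,p_c$ with $w_{t,c}\ge 0$, $\sum_c w_{t,c}=1$. The function $p_{\mathscr A}(\mathbf x)$ of the circuit is that of its root, and its size is the number of edges. Sum/leaf nodes alternate with product nodes, and each product node has two children. The scope of a node is the set of variables of the leaves below it; the root has scope $\mathbf X$. A vtree is a rooted binary tree whose leaves are in bijection with $\mathbf X$; $\mathbf X_v$ is the set of variables below its node $v$. A structured PC respecting a vtree $V$ is a PC that is smooth (the children of a sum node have equal scopes), decomposable (the children of a product node have disjoint scopes), and such that the two children of each product node have scopes $\mathbf X_l,\mathbf X_r$ for some inner node of $V$ with children $l,r$. Write $\mathrm{prod}(v)$ for the set of product nodes with scope $\mathbf X_v$; the hidden state size is $\max_{v\in V}|\mathrm{prod}(v)|$. **Bayesian network.** Let $\mathscr A$ be a structured PC respecting $V$. Its network $G_{\mathscr A}$ has graph $V$, with each inner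 node $v$ replaced by a latent variable $Z_v$ with values in $\mathrm{prod}(v)$ and each leaf replaced by its variable. If $v$ is the root of $V$, let $s$ be the root of $\mathscr A$; otherwise, given the value $t\in\mathrm{prod}(p)$ of the latent variable of the parent $p$ of $v$, let $s$ be the child of $t$ with scope $\mathbf X_v$. For inner $v$, the conditional probability that $Z_v=t'$ is the weight of the edge from $s$ to $t'$, or $0$ if there is no such edge (if the root of $\mathscr A$ is a product node, it is read as a sum node with that single child and weight $1$). For a leaf $v$, the conditional density of its variable is the leaf function of $s$. **Labellings.** Let $W$ be a vtree over $\mathbf X$. A set blocks a path of the underlying undirected tree if it contains a vertex of the path (end points included). A valid labelling assigns to each node $w\in W$ a set $\mathbf C_w$ of latent variables of $G_{\mathscr A}$ such that $\mathbf C_w$ blocks all paths between $\mathbf X_w$ and $\mathbf X\setminus\mathbf X_w$; for each inner node $w$ with children $l,r$, $\mathbf C_l$ blocks all paths between $\mathbf X_l$ and $\mathbf C_r\cup\mathbf C_w$, and $\mathbf C_r$ blocks all paths between $\mathbf X_r$ and $\mathbf C_l\cup\mathbf C_w$; the root of $W$ has label $\varnothing$; and the label of a leaf $X_j$ consists of the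 parent of $X_j$ in $G_{\mathscr A}$ (it is empty if $n=1$). **Algorithm.** Given $\mathscr A$, $V$, $W$ and a valid labelling, the restructured circuit $\mathscr A'$ is built as follows. For each leaf $X_j$ of $W$ and each value of $\mathbf C_{X_j}$, take a leaf node computing $p(X_j\mid \mathbf C_{X_j})$. For each inner node $w$ with children $l,r$ and each joint value $d$ of $\mathbf C_l\cup\mathbf C_r$, take a product node whose children are the nodes built for $l$ and $r$ at the values to which $d$ restricts on $\mathbf C_l$ and $\mathbf C_r$; and for each joint value $c$ of $\mathbf C_w$, take a sum node whose children are the product nodes for all $d$ agreeing with $c$, with weights $p(\mathbf C_l\cup\mathbf C_r=d\mid\mathbf C_w=c)$ computed in $G_{\mathscr A}$ (uniform weights if $p(\mathbf C_w=c)=0$). The root of $\mathscr A'$ is the unique node built for the root of $W$ and the empty assignment. **Theorem.** Let $\mathscr A$ be a structured PC over $n$ variables respecting $V$, with hidden state size $h$, let $W$ be a vtree over the same variables, and let $(\mathbf C_w)_{w\in W}$ be a valid labelling of $W$ with respect to $G_{\mathscr A}$. Put $M=\max_w|\mathbf C_l\cup\mathbf C_r|$ and $M'=\max_w|\mathbf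 C_l\cup\mathbf C_r\cup\mathbf C_w|$, where $w$ ranges over the inner nodes of $W$ and $l,r$ are the children of $w$ (an empty maximum is $0$, and $0^0=1$). Then the restructured circuit $\mathscr A'$ is a structured PC respecting $W$, $p_{\mathscr A'}(\mathbf x)=p_{\mathscr A}(\mathbf x)$ for all $\mathbf x$, the hidden state size of $\mathscr A'$ is $O(h^{M})$, the size of $\mathscr A'$ is $O(nh^{M'})$, and $M'\le 2M$. The constants in $O(\cdot)$ are absolute. -/

import Mathlib

open scoped NNReal ENNReal

universe u v w

/-! ### Vtrees -/

/-- Rooted binary trees with leaves tagged by variables. A node of a vtree is identified with the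
subtree hanging below it; in a vtree (`VTree.IsVtree`) distinct nodes have distinct subtrees. -/
inductive VTree (ι : Type u) : Type u
  | leaf (i : ι) : VTree ι
  | node (l r : VTree ι) : VTree ι
  deriving DecidableEq

namespace VTree

variable {ι : Type u}

/-- Number of leaves. -/
def numLeaves : VTree ι → ℕ
  | leaf _ => 1
  | node l r => l.numLeaves + r.numLeaves

def isInner : VTree ι → Bool
  | leaf _ => false
  | node _ _ => true

/-- `p.IsParent v`: `v` is one of the two children of `p`. -/
def IsParent (p v : VTree ι) : Prop := ∃ s : VTree ι, p = node v s ∨ p = node s v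

theorem numLeaves_pos : ∀ V : VTree ι, 0 < V.numLeaves
  | leaf _ => Nat.one_pos
  | node l r => Nat.add_pos_left (numLeaves_pos l) r.numLeaves

variable [DecidableEq ι]

/-- The set `X_v` of variables covered by a node `v`. -/
def vars : VTree ι → Finset ι
  | leaf i => {i}
  | node l r => l.vars ∪ r.vars

/-- The nodes of `V` (subtrees, `V` itself being the root). -/
def nodes : VTree ι → Finset (VTree ι)
  | leaf i => {leaf i}
  | node l r => insert (node l r) (l.nodes ∪ r.nodes)

/-- The inner (non-leaf) nodes of `V`. -/
def inner (V : VTree ι) : Finset (VTree ι) := V.nodes.filter fun v => v.isInner = true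

/-- No variable occurs at two leaves. -/
def LeavesDistinct : VTree ι → Prop
  | leaf _ => True
  | node l r => l.LeavesDistinct ∧ r.LeavesDistinct ∧ Disjoint l.vars r.vars

/-- `V` is a vtree over all of the variables `ι`: each variable sits at exactly one leaf. -/
def IsVtree [Fintype ι] (V : VTree ι) : Prop := V.LeavesDistinct ∧ V.vars = Finset.univ

theorem mem_nodes_self (V : VTree ι) : V ∈ V.nodes := by
  cases V <;> simp [nodes]

theorem children_mem_nodes {V l r : VTree ι} (h : node l r ∈ V.nodes) :
    l ∈ V.nodes ∧ r ∈ V.nodes := by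
  induction V with
  | leaf i => simp [nodes] at h
  | node a b iha ihb =>
    simp only [nodes, Finset.mem_insert, Finset.mem_union] at h ⊢
    rcases h with h | h | h
    · cases h
      exact ⟨Or.inr (Or.inl (mem_nodes_self l)), Or.inr (Or.inr (mem_nodes_self r))⟩
    · exact ⟨Or.inr (Or.inl (iha h).1), Or.inr (Or.inl (iha h).2)⟩
    · exact ⟨Or.inr (Or.inr (ihb h).1), Or.inr (Or.inr (ihb h).2)⟩

theorem node_mem_inner {V l r : VTree ι} (h : node l r ∈ V.nodes) : node l r ∈ V.inner :=
  Finset.mem_filter.mpr ⟨h, rfl⟩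

end VTree

/-! ### Circuits -/

/-- The three kinds of circuit nodes. A leaf carries its variable `X_i` and its input function. -/
inductive NodeKind (ι : Type u) (E : ι → Type v) : Type (max u v)
  | leaf (i : ι) (f : E i → ℝ≥0) : NodeKind ι E
  | prod : NodeKind ι E
  | sum : NodeKind ι E

namespace NodeKind

variable {ι : Type u} {E : ι → Type v}

def isProd : NodeKind ι E → Bool
  | prod => true
  | _ => false

def isSum : NodeKind ι E → Bool
  | sum => true
  | _ => false

end NodeKind

/-- A computation graph: a finite directed acyclic graph with a root, a kind for every node, and
non-negative edge weights (used only on edges leaving sum nodes). The variable `X_i` takes values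
in `E i`. -/
structure Circuit (ι : Type u) (E : ι → Type v) where
  Node : Type w
  fintypeNode : Fintype Node
  decEqNode : DecidableEq Node
  root : Node
  kind : Node → NodeKind ι E
  children : Node → Finset Node
  weight : Node → Node → ℝ≥0
  acyclic : WellFounded fun c t : Node => c ∈ children t

attribute [instance] Circuit.fintypeNode Circuit.decEqNode

namespace Circuit

variable {ι : Type u} {E : ι → Type v}

/-- The function `p_t` represented by a node. -/
noncomputable def eval (A : Circuit.{u, v, w} ι E) (x : ∀ i, E i) : A.Node → ℝ≥0 :=
  A.acyclic.fix fun t ih =>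
    match A.kind t with
    | .leaf i f => f (x i)
    | .prod => ∏ c ∈ (A.children t).attach, ih c.1 c.2
    | .sum => ∑ c ∈ (A.children t).attach, A.weight t c.1 * ih c.1 c.2

theorem eval_eq (A : Circuit.{u, v, w} ι E) (x : ∀ i, E i) (t : A.Node) :
    A.eval x t =
      match A.kind t with
      | .leaf i f => f (x i)
      | .prod => ∏ c ∈ A.children t, A.eval x c
      | .sum => ∑ c ∈ A.children t, A.weight t c * A.eval x c := by
  rw [eval, WellFounded.fix_eq]
  split
  · rfl
  · exact Finset.prod_attach (A.children t) (fun c => A.eval x c)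
  · exact Finset.sum_attach (A.children t) (fun c => A.weight t c * A.eval x c)

/-- The function `p_A` represented by the circuit. -/
noncomputable def density (A : Circuit.{u, v, w} ι E) (x : ∀ i, E i) : ℝ≥0 := A.eval x A.root

/-- The size of a circuit is its number of edges. -/
def size (A : Circuit.{u, v, w} ι E) : ℕ := ∑ t : A.Node, (A.children t).card

variable [DecidableEq ι]

/-- The scope of a node. -/
noncomputable def scope (A : Circuit.{u, v, w} ι E) : A.Node → Finset ι :=
  A.acyclic.fix fun t ih =>
    match A.kind t with
    | .leaf i _ => {i}
    | _ => (A.children t).attach.biUnion fun c => ih c.1 c.2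

theorem scope_eq (A : Circuit.{u, v, w} ι E) (t : A.Node) :
    A.scope t =
      match A.kind t with
      | .leaf i _ => {i}
      | _ => (A.children t).biUnion A.scope := by
  rw [scope, WellFounded.fix_eq]
  split
  · rfl
  · ext i
    simp only [Finset.mem_biUnion, Finset.mem_attach, true_and, Subtype.exists, exists_prop]

/-- `A` is a probabilistic circuit. The leaf functions are probability densities with respect to
reference measures `μ i` on the value spaces (counting measure for categorical leaves, Lebesgue
measure for Gaussian ones, and so on). -/
structure IsPC [∀ i, MeasurableSpace (E i)] (μ : ∀ i, MeasureTheory.Measure (E i))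
    (A : Circuit.{u, v, w} ι E) : Prop where
  leaf_no_children : ∀ t i f, A.kind t = .leaf i f → A.children t = ∅
  leaf_measurable : ∀ t i f, A.kind t = .leaf i f → Measurable f
  leaf_normalized : ∀ t i f, A.kind t = .leaf i f → ∫⁻ y, (f y : ℝ≥0∞) ∂(μ i) = 1
  sum_normalized : ∀ t, A.kind t = .sum → ∑ c ∈ A.children t, A.weight t c = 1
  rooted : ∀ t, Relation.ReflTransGen (fun a b => b ∈ A.children a) A.root t

/-- Sum/leaf nodes and product nodes alternate. -/
def Alternating (A : Circuit.{u, v, w} ι E) : Prop :=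
  (∀ t, A.kind t = .sum → ∀ c ∈ A.children t, A.kind c = .prod) ∧
    ∀ t, A.kind t = .prod → ∀ c ∈ A.children t, A.kind c ≠ .prod

/-- Each product node has exactly two children. -/
def BinaryProducts (A : Circuit.{u, v, w} ι E) : Prop :=
  ∀ t, A.kind t = .prod → (A.children t).card = 2

def Smooth (A : Circuit.{u, v, w} ι E) : Prop :=
  ∀ t, A.kind t = .sum → ∀ a ∈ A.children t, ∀ b ∈ A.children t, A.scope a = A.scope b

def Decomposable (A : Circuit.{u, v, w} ι E) : Prop :=
  ∀ t, A.kind t = .prod →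
    ∀ a ∈ A.children t, ∀ b ∈ A.children t, a ≠ b → Disjoint (A.scope a) (A.scope b)

/-- Structured decomposability with respect to `V`: every product node splits its scope in the way
some inner node of `V` does. -/
def Respects (A : Circuit.{u, v, w} ι E) (V : VTree ι) : Prop :=
  ∀ t, A.kind t = .prod → ∃ l r : VTree ι, VTree.node l r ∈ V.nodes ∧
    ∃ a b : A.Node, A.children t = {a, b} ∧ A.scope a = l.vars ∧ A.scope b = r.vars

/-- `A` is a structured PC over all the variables `ι`, respecting the vtree `V`. -/
structure IsStructuredPC [Fintype ι] [∀ i, MeasurableSpace (E i)]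
    (μ : ∀ i, MeasureTheory.Measure (E i)) (A : Circuit.{u, v, w} ι E) (V : VTree ι) : Prop where
  isPC : A.IsPC μ
  scope_root : A.scope A.root = Finset.univ
  alternating : A.Alternating
  binaryProducts : A.BinaryProducts
  smooth : A.Smooth
  decomposable : A.Decomposable
  respects : A.Respects V

/-- `prod(v)`: the product nodes whose scope is `X_v`. -/
noncomputable def prodNodes (A : Circuit.{u, v, w} ι E) (z : VTree ι) : Finset A.Node :=
  Finset.univ.filter fun t => (A.kind t).isProd = true ∧ A.scope t = z.vars

/-- The hidden state size `max_v |prod(v)|`. -/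
noncomputable def hiddenSize (A : Circuit.{u, v, w} ι E) (V : VTree ι) : ℕ :=
  V.nodes.sup fun z => (A.prodNodes z).card

/-! ### The Bayesian network of a structured PC

Its graph is `V` itself: a leaf `leaf i` of `V` stands for the observed variable `X_i`, an inner
node `z` of `V` for a latent variable `Z_z` with values in `prod(z)`. -/

/-- Joint values of the latent variables in `C`. -/
abbrev Assign (A : Circuit.{u, v, w} ι E) (C : Finset (VTree ι)) : Type (max u w) :=
  ∀ z : {z // z ∈ C}, {t // t ∈ A.prodNodes z.1}

/-- Two partial assignments agree wherever both are defined. -/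
def Agree (A : Circuit.{u, v, w} ι E) {C D : Finset (VTree ι)} (c : A.Assign C) (d : A.Assign D) :
    Prop :=
  ∀ (z : VTree ι) (hC : z ∈ C) (hD : z ∈ D), (c ⟨z, hC⟩ : A.Node) = d ⟨z, hD⟩

def restrict (A : Circuit.{u, v, w} ι E) {C D : Finset (VTree ι)} (h : C ⊆ D) (d : A.Assign D) :
    A.Assign C :=
  fun z => d ⟨z.1, h z.2⟩

/-- The sum or leaf node that governs the variable at `z ∈ V` once the latent variables in `C` have
the values `c`: the root of the circuit if `z` is the root of `V`, and otherwise the child with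
scope `X_z` of the product node assigned to the parent of `z`. (It is unique when `A` respects `V`
and `C` contains the parent of `z`.) -/
noncomputable def governor (A : Circuit.{u, v, w} ι E) (V : VTree ι) {C : Finset (VTree ι)}
    (c : A.Assign C) (z : VTree ι) : A.Node :=
  haveI : Nonempty A.Node := ⟨A.root⟩
  Classical.epsilon fun s =>
    (z = V ∧ s = A.root) ∨
      (z ≠ V ∧ ∃ p : {p // p ∈ C}, p.1.IsParent z ∧ s ∈ A.children (c p) ∧ A.scope s = z.vars)

/-- The conditional probability `p(Z_z | Z_parent)` (for the root of `V`: `p(Z_root)`): the weight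
of the edge from the governing sum node to the value of `Z_z`, and `0` if there is no such edge.
A governing node that is itself a product node occurs only as the root of the circuit; it is
read as a sum node with one edge, of weight `1`. -/
noncomputable def latentCPT (A : Circuit.{u, v, w} ι E) (V : VTree ι) (a : A.Assign V.inner)
    (z : {z // z ∈ V.inner}) : ℝ≥0 :=
  let s := A.governor V a z.1
  if (A.kind s).isProd = true then (if (a z : A.Node) = s then 1 else 0)
  else if (a z : A.Node) ∈ A.children s then A.weight s (a z) else 0

/-- The joint distribution of all latent variables in the Bayesian network (the conditional
densities of the observed variables integrate to `1` and drop out). -/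
noncomputable def latentJoint (A : Circuit.{u, v, w} ι E) (V : VTree ι) (a : A.Assign V.inner) :
    ℝ≥0 :=
  ∏ z : {z // z ∈ V.inner}, A.latentCPT V a z

open scoped Classical in
/-- The probability `p(C = c, D = d)`. -/
noncomputable def latentProb (A : Circuit.{u, v, w} ι E) (V : VTree ι) {C D : Finset (VTree ι)}
    (c : A.Assign C) (d : A.Assign D) : ℝ≥0 :=
  ∑ a : A.Assign V.inner, if A.Agree a c ∧ A.Agree a d then A.latentJoint V a else 0

open scoped Classical in
/-- The conditional probability `p(D = d | C = c)` for agreeing `c`, `d`. When `C = c` has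
probability `0`, where any distribution may be used, it is the uniform distribution on the
assignments `d` that agree with `c`. -/
noncomputable def latentCond (A : Circuit.{u, v, w} ι E) (V : VTree ι) {C D : Finset (VTree ι)}
    (c : A.Assign C) (d : A.Assign D) : ℝ≥0 :=
  if A.latentProb V c c = 0 then
    ((Finset.univ.filter fun e : A.Assign D => A.Agree c e).card : ℝ≥0)⁻¹
  else A.latentProb V c d / A.latentProb V c c

end Circuit

/-! ### Valid labellings -/

section Labelling

variable {ι : Type u} [DecidableEq ι]

/-- The undirected skeleton of the tree `V` (all vertices that are not nodes of `V` are isolated);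
this is the skeleton of the Bayesian network of any structured PC respecting `V`. -/
def VTree.skeleton (V : VTree ι) : SimpleGraph (VTree ι) :=
  SimpleGraph.fromRel fun p z => p ∈ V.nodes ∧ p.IsParent z

/-- `C` blocks all paths of `G` between `S` and `T` (end points included). -/
def Blocks {α : Type*} (G : SimpleGraph α) (C S T : Set α) : Prop :=
  ∀ s ∈ S, ∀ t ∈ T, ∀ p : G.Walk s t, p.IsPath → ∃ z ∈ p.support, z ∈ C

/-- The observed vertices of a set of variables. -/
def observed (S : Finset ι) : Set (VTree ι) := VTree.leaf '' (S : Set ι)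

/-- `C` covers the set `S` of observed variables in the network with graph `V`. -/
def Covers [Fintype ι] (V : VTree ι) (C : Finset (VTree ι)) (S : Finset ι) : Prop :=
  Blocks V.skeleton (C : Set (VTree ι)) (observed S) (observed Sᶜ)

/-- `C_l ∪ C_r` for an inner node with children `l` and `r`. -/
def childLabel (C : VTree ι → Finset (VTree ι)) : VTree ι → Finset (VTree ι)
  | .leaf _ => ∅
  | .node l r => C l ∪ C r

/-- `C` is a valid labelling of `W` by sets of latent variables of the network with graph `V`.
Only the values of `C` at nodes of `W` matter. -/
structure ValidLabelling [Fintype ι] (V W : VTree ι) (C : VTree ι → Finset (VTree ι)) : Prop where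
  latent : ∀ z ∈ W.nodes, C z ⊆ V.inner
  covers : ∀ z ∈ W.nodes, Covers V (C z) z.vars
  blocks_left : ∀ l r, VTree.node l r ∈ W.nodes →
    Blocks V.skeleton (C l : Set (VTree ι)) (observed l.vars)
      (C r ∪ C (.node l r) : Finset (VTree ι))
  blocks_right : ∀ l r, VTree.node l r ∈ W.nodes →
    Blocks V.skeleton (C r : Set (VTree ι)) (observed r.vars)
      (C l ∪ C (.node l r) : Finset (VTree ι))
  root : C W = ∅
  leaf : ∀ j : ι, ∀ p : VTree ι, p ∈ C (.leaf j) ↔ p ∈ V.inner ∧ p.IsParent (.leaf j)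

/-- `M`, the maximum of `|C_l ∪ C_r|` over the inner nodes of `W`. -/
def childCardinality (W : VTree ι) (C : VTree ι → Finset (VTree ι)) : ℕ :=
  W.inner.sup fun z => (childLabel C z).card

/-- `M'`, the maximum of `|C_l ∪ C_r ∪ C_w|` over the inner nodes `w` of `W`. -/
def labelCardinality (W : VTree ι) (C : VTree ι → Finset (VTree ι)) : ℕ :=
  W.inner.sup fun z => (childLabel C z ∪ C z).card

end Labelling

/-! ### The restructuring algorithm -/

namespace Circuit

variable {ι : Type u} {E : ι → Type v} [DecidableEq ι]

/-- The nodes built by the algorithm: for every node `z` of `W` a vector of nodes indexed by the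
values of `C_z`, representing `p(X_z | C_z)`, and for every inner node with children `l`, `r` a
layer of product nodes indexed by the values of `C_l ∪ C_r`. -/
abbrev RNode (A : Circuit.{u, v, w} ι E) (W : VTree ι) (C : VTree ι → Finset (VTree ι)) :
    Type (max u w) :=
  (Σ z : {z // z ∈ W.nodes}, A.Assign (C z.1)) ⊕
    (Σ z : {z // z ∈ W.inner}, A.Assign (childLabel C z.1))

/-- At a leaf `X_i` of `W` the vector consists of copies of the leaves of `A` giving
`p(X_i | parent of X_i)`. -/
noncomputable def rkind (A : Circuit.{u, v, w} ι E) (V W : VTree ι)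
    (C : VTree ι → Finset (VTree ι)) : A.RNode W C → NodeKind ι E
  | .inl ⟨⟨.leaf i, _⟩, c⟩ => A.kind (A.governor V c (.leaf i))
  | .inl ⟨⟨.node _ _, _⟩, _⟩ => .sum
  | .inr _ => .prod

open scoped Classical in
/-- The sum node for `C_z = c` has as children the product nodes whose index agrees with `c`;
the product node with index `d` multiplies the nodes of the two children of `z` indexed by the
restrictions of `d` to `C_l` and `C_r`. -/
noncomputable def rchildren (A : Circuit.{u, v, w} ι E) (W : VTree ι)
    (C : VTree ι → Finset (VTree ι)) : A.RNode W C → Finset (A.RNode W C)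
  | .inl ⟨⟨.leaf _, _⟩, _⟩ => ∅
  | .inl ⟨⟨.node l r, h⟩, c⟩ =>
      (Finset.univ.filter fun d : A.Assign (C l ∪ C r) => A.Agree c d).image
        fun d => .inr ⟨⟨.node l r, VTree.node_mem_inner h⟩, d⟩
  | .inr ⟨⟨.leaf _, _⟩, _⟩ => ∅
  | .inr ⟨⟨.node l r, h⟩, d⟩ =>
      have hW := VTree.children_mem_nodes (Finset.mem_filter.mp h).1
      {.inl ⟨⟨l, hW.1⟩, A.restrict (C := C l) (D := C l ∪ C r) Finset.subset_union_left d⟩,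
        .inl ⟨⟨r, hW.2⟩, A.restrict (C := C r) (D := C l ∪ C r) Finset.subset_union_right d⟩}

/-- The edge from the sum node for `C_w = c` to the product node for `C_l ∪ C_r = d` has weight
`p(C_l ∪ C_r = d | C_w = c)`. -/
noncomputable def rweight (A : Circuit.{u, v, w} ι E) (V W : VTree ι)
    (C : VTree ι → Finset (VTree ι)) : A.RNode W C → A.RNode W C → ℝ≥0
  | .inl ⟨_, c⟩, .inr ⟨_, d⟩ => A.latentCond V c d
  | _, _ => 0

def rrank (A : Circuit.{u, v, w} ι E) (W : VTree ι)
    (C : VTree ι → Finset (VTree ι)) : A.RNode W C → ℕ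
  | .inl z => 2 * z.1.1.numLeaves + 1
  | .inr z => 2 * z.1.1.numLeaves

theorem rrank_lt (A : Circuit.{u, v, w} ι E) (W : VTree ι) (C : VTree ι → Finset (VTree ι))
    (t c : A.RNode W C) (h : c ∈ A.rchildren W C t) : A.rrank W C c < A.rrank W C t := by
  match t, h with
  | .inl ⟨⟨.leaf _, _⟩, _⟩, h => simp [rchildren] at h
  | .inl ⟨⟨.node l r, hz⟩, e⟩, h =>
    simp only [rchildren] at h
    obtain ⟨d, -, rfl⟩ := Finset.mem_image.mp h
    simp [rrank]
  | .inr ⟨⟨.leaf _, _⟩, _⟩, h => simp [rchildren] at h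
  | .inr ⟨⟨.node l r, hz⟩, d⟩, h =>
    have hl := l.numLeaves_pos
    have hr := r.numLeaves_pos
    simp only [rchildren, Finset.mem_insert, Finset.mem_singleton] at h
    rcases h with rfl | rfl <;> simp only [rrank, VTree.numLeaves] <;> omega

open scoped Classical in
/-- The circuit built by the restructuring algorithm from `A` (respecting `V`), the target vtree
`W` and the labelling `C`. Its root is the entry of the vector at the root of `W`; for a valid
labelling that vector has exactly one entry, because the label of the root is empty. -/
noncomputable def restructure (A : Circuit.{u, v, w} ι E) (V W : VTree ι)
    (C : VTree ι → Finset (VTree ι)) (hroot : C W = ∅) : Circuit.{u, v, max u w} ι E where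
  Node := A.RNode W C
  fintypeNode := inferInstance
  decEqNode := inferInstance
  root := .inl ⟨⟨W, W.mem_nodes_self⟩,
    fun z => absurd z.2 (Finset.eq_empty_iff_forall_notMem.mp hroot z.1)⟩
  kind := A.rkind V W C
  children := A.rchildren W C
  weight := A.rweight V W C
  acyclic := Subrelation.wf (fun {c t} h => A.rrank_lt W C t c h)
    (InvImage.wf (A.rrank W C) Nat.lt_wfRel.wf)

end Circuit

/-! The network of `A` is a tree. A full assignment of its latent variables has as weight the
product of the conditional probabilities, and each observed variable adds the leaf function of its
governor. Summing over the latent variables, from the leaves of `V` up, undoes the recursion of the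
circuit and returns its density (`IsStructuredPC.sum_latentJoint_mul`).

Correctness is an induction up `W` on the invariant `mass_mul_eval`: the node built for `z` and `c`,
multiplied by p(C_z = c), equals the joint mass of C_z = c and X_z. At a leaf the label holds the
parent, which fixes the leaf function. At an inner node one needs p(X_l, X_r, c, d) p(d_l) p(d_r) =
p(X_l, d_l) p(X_r, d_r) p(c, d), which follows from two conditional independences: C_l splits off
X_l, then C_r splits off X_r (`mass_agree_union`). At the root the label is empty, and the invariant
is equality of densities.

Independence is obtained without division from an exchange argument (`mass_mul_mass`). Take two full
assignments agreeing on C and exchange their values on the set R reached from X_S without meeting C.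
Each conditional probability involves only a vertex and its parent, and an edge leaving R ends in C,
where the assignments agree. So the product of the two weights is unchanged, and the exchange is an
involution on pairs.

For the bounds, product nodes at w are indexed by values of C_l ∪ C_r, and edges leaving the sum
nodes at w by values of C_l ∪ C_r ∪ C_w. Every C_w is empty or part of the child label of the parent
of w, whence M' ≤ 2M. -/

namespace VTree

/-! ### Combinatorics of vtrees. -/

variable {ι : Type u}

theorem IsParent.numLeaves_lt {p z : VTree ι} (h : p.IsParent z) : z.numLeaves < p.numLeaves := by
  obtain ⟨s, rfl | rfl⟩ := h
  · exact Nat.lt_add_of_pos_right s.numLeaves_pos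
  · exact Nat.lt_add_of_pos_left s.numLeaves_pos

theorem isParent_left (l r : VTree ι) : (node l r).IsParent l := ⟨r, Or.inl rfl⟩

theorem isParent_right (l r : VTree ι) : (node l r).IsParent r := ⟨l, Or.inr rfl⟩

variable [DecidableEq ι]

theorem vars_nonempty (V : VTree ι) : V.vars.Nonempty := by
  induction V with
  | leaf i => exact Finset.singleton_nonempty i
  | node l r ihl _ => exact ihl.mono Finset.subset_union_left

theorem mem_nodes_node {l r z : VTree ι} :
    z ∈ (node l r).nodes ↔ z = node l r ∨ z ∈ l.nodes ∨ z ∈ r.nodes := by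
  simp [nodes]

theorem mem_inner_node {l r z : VTree ι} :
    z ∈ (node l r).inner ↔ z = node l r ∨ z ∈ l.inner ∨ z ∈ r.inner := by
  simp only [inner, Finset.mem_filter, mem_nodes_node]
  constructor
  · rintro ⟨h | h | h, h'⟩
    · exact Or.inl h
    · exact Or.inr (Or.inl ⟨h, h'⟩)
    · exact Or.inr (Or.inr ⟨h, h'⟩)
  · rintro (rfl | ⟨h, h'⟩ | ⟨h, h'⟩)
    · exact ⟨Or.inl rfl, rfl⟩
    · exact ⟨Or.inr (Or.inl h), h'⟩
    · exact ⟨Or.inr (Or.inr h), h'⟩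

theorem inner_leaf (i : ι) : (leaf i).inner = ∅ := by
  simp only [inner, nodes, Finset.filter_singleton]
  rfl

theorem mem_nodes_of_mem_inner {V z : VTree ι} (h : z ∈ V.inner) : z ∈ V.nodes :=
  (Finset.mem_filter.mp h).1

theorem leaf_notMem_inner (V : VTree ι) (i : ι) : leaf i ∉ V.inner := fun h => by
  simpa [isInner] using (Finset.mem_filter.mp h).2

theorem nodes_trans {V a z : VTree ι} (ha : a ∈ V.nodes) (hz : z ∈ a.nodes) : z ∈ V.nodes := by
  induction V with
  | leaf i =>
    rw [nodes, Finset.mem_singleton] at ha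
    exact ha ▸ hz
  | node l r ihl ihr =>
    rcases mem_nodes_node.mp ha with rfl | h | h
    · exact hz
    · exact mem_nodes_node.mpr (Or.inr (Or.inl (ihl h)))
    · exact mem_nodes_node.mpr (Or.inr (Or.inr (ihr h)))

theorem inner_subset_of_mem_nodes {V a : VTree ι} (ha : a ∈ V.nodes) : a.inner ⊆ V.inner :=
  fun _ hz => Finset.mem_filter.mpr
    ⟨nodes_trans ha (mem_nodes_of_mem_inner hz), (Finset.mem_filter.mp hz).2⟩

theorem vars_subset_of_mem_nodes {V z : VTree ι} (h : z ∈ V.nodes) : z.vars ⊆ V.vars := by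
  induction V with
  | leaf i =>
    rw [nodes, Finset.mem_singleton] at h
    rw [h]
  | node l r ihl ihr =>
    rcases mem_nodes_node.mp h with rfl | h | h
    · exact subset_rfl
    · exact (ihl h).trans Finset.subset_union_left
    · exact (ihr h).trans Finset.subset_union_right

theorem leaf_mem_nodes {V : VTree ι} {i : ι} (h : i ∈ V.vars) : leaf i ∈ V.nodes := by
  induction V with
  | leaf j =>
    rw [vars, Finset.mem_singleton] at h
    exact h ▸ mem_nodes_self _
  | node l r ihl ihr =>
    rcases Finset.mem_union.mp h with h | h
    · exact mem_nodes_node.mpr (Or.inr (Or.inl (ihl h)))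
    · exact mem_nodes_node.mpr (Or.inr (Or.inr (ihr h)))

theorem numLeaves_le_of_mem_nodes {V z : VTree ι} (h : z ∈ V.nodes) :
    z.numLeaves ≤ V.numLeaves := by
  induction V with
  | leaf i =>
    rw [nodes, Finset.mem_singleton] at h
    rw [h]
  | node l r ihl ihr =>
    rcases mem_nodes_node.mp h with rfl | h | h
    · exact le_rfl
    · exact (ihl h).trans (Nat.le_add_right _ _)
    · exact (ihr h).trans (Nat.le_add_left _ _)

theorem IsParent.mem_inner {V p z : VTree ι} (hp : p ∈ V.nodes) (h : p.IsParent z) :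
    p ∈ V.inner := by
  obtain ⟨s, rfl | rfl⟩ := h <;> exact node_mem_inner hp

theorem IsParent.vars_subset {p z : VTree ι} (h : p.IsParent z) : z.vars ⊆ p.vars := by
  obtain ⟨s, rfl | rfl⟩ := h
  · exact Finset.subset_union_left
  · exact Finset.subset_union_right

theorem IsParent.ne_root {V p z : VTree ι} (hp : p ∈ V.nodes) (h : p.IsParent z) : z ≠ V := by
  rintro rfl
  exact absurd (numLeaves_le_of_mem_nodes hp) (not_le.mpr h.numLeaves_lt)

/-- Induction from the root downwards. -/
theorem nodes_induction {V : VTree ι} {P : VTree ι → Prop} (root : P V)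
    (step : ∀ p z, p ∈ V.nodes → p.IsParent z → P p → P z) {z : VTree ι} (hz : z ∈ V.nodes) :
    P z := by
  suffices H : ∀ a ∈ V.nodes, P a → ∀ z ∈ a.nodes, P z from H V V.mem_nodes_self root z hz
  intro a
  induction a with
  | leaf i =>
    intro _ h z hz
    rw [nodes, Finset.mem_singleton] at hz
    exact hz ▸ h
  | node l r ihl ihr =>
    intro ha h z hz
    rcases mem_nodes_node.mp hz with rfl | hz | hz
    · exact h
    · exact ihl (children_mem_nodes ha).1 (step _ _ ha (isParent_left l r) h) z hz
    · exact ihr (children_mem_nodes ha).2 (step _ _ ha (isParent_right l r) h) z hz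

theorem LeavesDistinct.of_mem_nodes {V z : VTree ι} (hV : V.LeavesDistinct) (h : z ∈ V.nodes) :
    z.LeavesDistinct := by
  refine nodes_induction (P := LeavesDistinct) hV ?_ h
  rintro p z - ⟨s, rfl | rfl⟩ hp
  · exact hp.1
  · exact hp.2.1

theorem LeavesDistinct.disjoint {V l r : VTree ι} (hV : V.LeavesDistinct)
    (h : node l r ∈ V.nodes) : Disjoint l.vars r.vars :=
  (hV.of_mem_nodes h).2.2

theorem LeavesDistinct.ne {V l r : VTree ι} (hV : V.LeavesDistinct)
    (h : node l r ∈ V.nodes) : l ≠ r := by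
  rintro rfl
  exact l.vars_nonempty.ne_empty (disjoint_self.mp (hV.disjoint h))

theorem LeavesDistinct.two_le_card {l r : VTree ι} (h : (node l r).LeavesDistinct) :
    2 ≤ (node l r).vars.card := by
  rw [vars, Finset.card_union_of_disjoint h.2.2]
  exact Nat.add_le_add l.vars_nonempty.card_pos r.vars_nonempty.card_pos

/-- Nodes of a vtree whose variable sets overlap lie on one branch. -/
theorem LeavesDistinct.comparable {V a b : VTree ι} (hV : V.LeavesDistinct) (ha : a ∈ V.nodes)
    (hb : b ∈ V.nodes) (h : ¬ Disjoint a.vars b.vars) : a ∈ b.nodes ∨ b ∈ a.nodes := by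
  induction V with
  | leaf i =>
    rw [nodes, Finset.mem_singleton] at ha hb
    subst ha hb
    exact Or.inl (mem_nodes_self _)
  | node l r ihl ihr =>
    rcases mem_nodes_node.mp ha with rfl | ha' | ha'
    · exact Or.inr hb
    all_goals rcases mem_nodes_node.mp hb with rfl | hb' | hb'
    · exact Or.inl ha
    · exact ihl hV.1 ha' hb'
    · exact absurd (hV.2.2.mono (vars_subset_of_mem_nodes ha') (vars_subset_of_mem_nodes hb')) h
    · exact Or.inl ha
    · exact absurd (hV.2.2.symm.mono (vars_subset_of_mem_nodes ha')
        (vars_subset_of_mem_nodes hb')) h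
    · exact ihr hV.2.1 ha' hb'

theorem LeavesDistinct.eq_of_mem_nodes_of_subset {a b : VTree ι} (ha : a.LeavesDistinct)
    (h : b ∈ a.nodes) (hs : a.vars ⊆ b.vars) : b = a := by
  cases a with
  | leaf i => exact Finset.mem_singleton.mp h
  | node l r =>
    rcases mem_nodes_node.mp h with h | h | h
    · exact h
    · have : r.vars ⊆ l.vars :=
        Finset.subset_union_right.trans (hs.trans (vars_subset_of_mem_nodes h))
      exact absurd (ha.2.2 this subset_rfl) (by simpa using r.vars_nonempty.ne_empty)
    · have : l.vars ⊆ r.vars :=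
        Finset.subset_union_left.trans (hs.trans (vars_subset_of_mem_nodes h))
      exact absurd (ha.2.2 subset_rfl this) (by simpa using l.vars_nonempty.ne_empty)

/-- This lets a scope stand for a vtree node. Equal nonempty variable sets overlap, so the nodes lie
on one branch, and a proper descendant always misses the variables of some sibling. -/
theorem LeavesDistinct.eq_of_vars_eq {V a b : VTree ι} (hV : V.LeavesDistinct) (ha : a ∈ V.nodes)
    (hb : b ∈ V.nodes) (h : a.vars = b.vars) : a = b := by
  have hd : ¬ Disjoint a.vars b.vars := by
    rw [h, disjoint_self]
    exact b.vars_nonempty.ne_empty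
  rcases hV.comparable ha hb hd with h' | h'
  · exact (hV.of_mem_nodes hb).eq_of_mem_nodes_of_subset h' h.ge
  · exact ((hV.of_mem_nodes ha).eq_of_mem_nodes_of_subset h' h.le).symm

theorem LeavesDistinct.parent_eq_of_mem {p q z : VTree ι} (hp : p.LeavesDistinct)
    (hpz : p.IsParent z) (hqz : q.IsParent z) (h : q ∈ p.nodes) : q = p := by
  have key : ∀ s : VTree ι, Disjoint z.vars s.vars → q ∉ s.nodes := fun s hd hq =>
    z.vars_nonempty.ne_empty
      (disjoint_self.mp (hd.mono_right (hqz.vars_subset.trans (vars_subset_of_mem_nodes hq))))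
  have key' : q ∉ z.nodes := fun hq =>
    absurd (numLeaves_le_of_mem_nodes hq) (not_le.mpr hqz.numLeaves_lt)
  obtain ⟨s, rfl | rfl⟩ := hpz
  · rcases mem_nodes_node.mp h with h | h | h
    · exact h
    · exact absurd h key'
    · exact absurd h (key s hp.2.2)
  · rcases mem_nodes_node.mp h with h | h | h
    · exact h
    · exact absurd h (key s hp.2.2.symm)
    · exact absurd h key'

/-- Two parents of `z` overlap in the variables of `z`, hence lie on one branch. Uniqueness makes
the choice inside `governor` unambiguous. -/
theorem LeavesDistinct.parent_unique {V p q z : VTree ι} (hV : V.LeavesDistinct)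
    (hp : p ∈ V.nodes) (hq : q ∈ V.nodes) (hpz : p.IsParent z) (hqz : q.IsParent z) : p = q := by
  have hd : ¬ Disjoint p.vars q.vars := fun hd =>
    z.vars_nonempty.ne_empty (disjoint_self.mp (hd.mono hpz.vars_subset hqz.vars_subset))
  rcases hV.comparable hp hq hd with h | h
  · exact (hV.of_mem_nodes hq).parent_eq_of_mem hqz hpz h
  · exact ((hV.of_mem_nodes hp).parent_eq_of_mem hpz hqz h).symm

theorem exists_parent {V z : VTree ι} (h : z ∈ V.nodes) :
    z = V ∨ ∃ p ∈ V.nodes, p.IsParent z :=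
  nodes_induction (P := fun z => z = V ∨ ∃ p ∈ V.nodes, p.IsParent z) (Or.inl rfl)
    (fun p _ hp hz _ => Or.inr ⟨p, hp, hz⟩) h

theorem inner_node (l r : VTree ι) :
    (node l r).inner = insert (node l r) (l.inner ∪ r.inner) := by
  ext z
  rw [mem_inner_node, Finset.mem_insert, Finset.mem_union]

theorem node_notMem_inner_union (l r : VTree ι) : node l r ∉ l.inner ∪ r.inner := by
  intro h
  rcases Finset.mem_union.mp h with h | h
  · exact absurd (numLeaves_le_of_mem_nodes (mem_nodes_of_mem_inner h))
      (not_le.mpr (isParent_left l r).numLeaves_lt)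
  · exact absurd (numLeaves_le_of_mem_nodes (mem_nodes_of_mem_inner h))
      (not_le.mpr (isParent_right l r).numLeaves_lt)

theorem LeavesDistinct.disjoint_inner {l r : VTree ι} (h : (node l r).LeavesDistinct) :
    Disjoint l.inner r.inner := by
  refine Finset.disjoint_left.mpr fun z hl hr => z.vars_nonempty.ne_empty ?_
  exact disjoint_self.mp (h.2.2.mono (vars_subset_of_mem_nodes (mem_nodes_of_mem_inner hl))
    (vars_subset_of_mem_nodes (mem_nodes_of_mem_inner hr)))

/-- A binary tree has fewer inner nodes than leaves. This is the source of the factor n in the size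
bound. -/
theorem LeavesDistinct.card_inner_lt {V : VTree ι} (h : V.LeavesDistinct) :
    V.inner.card < V.vars.card := by
  induction V with
  | leaf i => simp [inner_leaf, vars]
  | node l r ihl ihr =>
    have h1 := ihl h.1
    have h2 := ihr h.2.1
    have h3 := Finset.card_insert_le (node l r) (l.inner ∪ r.inner)
    have h4 := Finset.card_union_le l.inner r.inner
    rw [inner_node, vars, Finset.card_union_of_disjoint h.2.2]
    omega

end VTree

/-! ### Scopes, product nodes and governors in a structured circuit. -/

namespace Circuit

variable {ι : Type u} {E : ι → Type v} {A : Circuit.{u, v, w} ι E}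

theorem eval_leaf {t : A.Node} {i : ι} {f : E i → ℝ≥0} (h : A.kind t = .leaf i f)
    (x : ∀ i, E i) : A.eval x t = f (x i) := by
  rw [eval_eq, h]

theorem eval_prod {t : A.Node} (h : A.kind t = .prod) (x : ∀ i, E i) :
    A.eval x t = ∏ c ∈ A.children t, A.eval x c := by
  rw [eval_eq, h]

theorem eval_sum {t : A.Node} (h : A.kind t = .sum) (x : ∀ i, E i) :
    A.eval x t = ∑ c ∈ A.children t, A.weight t c * A.eval x c := by
  rw [eval_eq, h]

variable [DecidableEq ι]

theorem scope_leaf {t : A.Node} {i : ι} {f : E i → ℝ≥0} (h : A.kind t = .leaf i f) :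
    A.scope t = {i} := by
  rw [scope_eq, h]

theorem scope_prod {t : A.Node} (h : A.kind t = .prod) :
    A.scope t = (A.children t).biUnion A.scope := by
  rw [scope_eq, h]

theorem scope_sum {t : A.Node} (h : A.kind t = .sum) :
    A.scope t = (A.children t).biUnion A.scope := by
  rw [scope_eq, h]

theorem mem_prodNodes {z : VTree ι} {t : A.Node} :
    t ∈ A.prodNodes z ↔ A.kind t = .prod ∧ A.scope t = z.vars := by
  rw [prodNodes, Finset.mem_filter]
  simp only [Finset.mem_univ, true_and]
  refine and_congr_left fun _ => ?_
  cases A.kind t <;> simp [NodeKind.isProd]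

/-- The weight with which the node `s` governing a latent variable selects the value `t`. -/
noncomputable def edgeWeight (A : Circuit.{u, v, w} ι E) (s t : A.Node) : ℝ≥0 :=
  if (A.kind s).isProd = true then (if t = s then 1 else 0)
  else if t ∈ A.children s then A.weight s t else 0

/-- The child of `t` whose scope is the set of variables of `z`. -/
noncomputable def childAt (A : Circuit.{u, v, w} ι E) (t : A.Node) (z : VTree ι) : A.Node :=
  haveI : Nonempty A.Node := ⟨A.root⟩
  Classical.epsilon fun s => s ∈ A.children t ∧ A.scope s = z.vars

theorem kind_of_scope_node {V : VTree ι} (hV : V.LeavesDistinct) {s : A.Node} {l r : VTree ι}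
    (h : VTree.node l r ∈ V.nodes) (hs : A.scope s = (VTree.node l r).vars) :
    A.kind s = .prod ∨ A.kind s = .sum := by
  match hk : A.kind s with
  | .leaf i f =>
    have := (hV.of_mem_nodes h).two_le_card
    rw [← hs, scope_leaf hk, Finset.card_singleton] at this
    omega
  | .prod => exact Or.inl rfl
  | .sum => exact Or.inr rfl

section Structured

variable [Fintype ι] [∀ i, MeasurableSpace (E i)] {μ : ∀ i, MeasureTheory.Measure (E i)}
  {V : VTree ι}

namespace IsStructuredPC

variable (hA : A.IsStructuredPC μ V)
include hA

theorem children_nonempty_of_sum {t : A.Node} (ht : A.kind t = .sum) :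
    (A.children t).Nonempty := by
  by_contra h
  have := hA.isPC.sum_normalized t ht
  rw [Finset.not_nonempty_iff_eq_empty.mp h, Finset.sum_empty] at this
  exact zero_ne_one this

theorem scope_of_mem_children_sum {s t : A.Node} (hs : A.kind s = .sum) (ht : t ∈ A.children s) :
    A.scope t = A.scope s := by
  rw [scope_sum hs]
  refine (Finset.Subset.antisymm (Finset.biUnion_subset.mpr fun c hc => ?_)
    (Finset.subset_biUnion_of_mem A.scope ht)).symm
  exact (hA.smooth s hs c hc t ht).le

theorem exists_scope_prod {t : A.Node} (ht : A.kind t = .prod) :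
    ∃ l r : VTree ι, VTree.node l r ∈ V.nodes ∧ A.scope t = (VTree.node l r).vars ∧
      ∃ a b : A.Node, A.children t = {a, b} ∧ A.scope a = l.vars ∧ A.scope b = r.vars := by
  obtain ⟨l, r, h, a, b, hab, ha, hb⟩ := hA.respects t ht
  refine ⟨l, r, h, ?_, a, b, hab, ha, hb⟩
  rw [scope_prod ht, hab, Finset.biUnion_insert, Finset.singleton_biUnion, ha, hb, VTree.vars]

variable (hV : V.IsVtree)
include hV

theorem two_le_card_scope_prod {t : A.Node} (ht : A.kind t = .prod) :
    2 ≤ (A.scope t).card := by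
  obtain ⟨l, r, h, hs, -⟩ := hA.exists_scope_prod ht
  rw [hs]
  exact (hV.1.of_mem_nodes h).two_le_card

/-- A product node has at least two variables in its scope, and a sum node has a product child of
the same scope, so only a leaf remains. -/
theorem kind_of_scope_singleton {t : A.Node} {i : ι} (ht : A.scope t = {i}) :
    ∃ f, A.kind t = .leaf i f := by
  match hk : A.kind t with
  | .leaf j f =>
    rw [scope_leaf hk, Finset.singleton_inj] at ht
    subst ht
    exact ⟨f, rfl⟩
  | .prod =>
    have := hA.two_le_card_scope_prod hV hk
    rw [ht, Finset.card_singleton] at this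
    omega
  | .sum =>
    obtain ⟨c, hc⟩ := hA.children_nonempty_of_sum hk
    have := hA.two_le_card_scope_prod hV (hA.alternating.1 t hk c hc)
    rw [hA.scope_of_mem_children_sum hk hc, ht, Finset.card_singleton] at this
    omega

/-- `respects` provides a split at some inner node of `V`; since the scope determines the vtree
node, it is the split into `l` and `r`. Hence `childAt` is a genuine choice with only one candidate.
-/
theorem children_of_mem_prodNodes {t : A.Node} {l r : VTree ι} (h : VTree.node l r ∈ V.nodes)
    (ht : t ∈ A.prodNodes (.node l r)) :
    A.childAt t l ≠ A.childAt t r ∧ A.children t = {A.childAt t l, A.childAt t r} ∧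
      A.scope (A.childAt t l) = l.vars ∧ A.scope (A.childAt t r) = r.vars := by
  obtain ⟨hk, hs⟩ := mem_prodNodes.mp ht
  obtain ⟨l', r', h', hs', a, b, hab, ha, hb⟩ := hA.exists_scope_prod hk
  obtain ⟨rfl, rfl⟩ : l = l' ∧ r = r' := by
    have := hV.1.eq_of_vars_eq h h' (hs.symm.trans hs')
    simpa using this
  have hne : l.vars ≠ r.vars := fun he => by
    have hd := hV.1.disjoint h
    rw [he, disjoint_self] at hd
    exact r.vars_nonempty.ne_empty hd
  have hl : A.childAt t l = a := by
    have : A.childAt t l ∈ A.children t ∧ A.scope (A.childAt t l) = l.vars :=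
      Classical.epsilon_spec (p := fun s => s ∈ A.children t ∧ A.scope s = l.vars)
        ⟨a, by rw [hab]; exact Finset.mem_insert_self _ _, ha⟩
    rw [hab, Finset.mem_insert, Finset.mem_singleton] at this
    exact this.1.resolve_right fun he => hne (this.2.symm.trans (he ▸ hb))
  have hr : A.childAt t r = b := by
    have : A.childAt t r ∈ A.children t ∧ A.scope (A.childAt t r) = r.vars :=
      Classical.epsilon_spec (p := fun s => s ∈ A.children t ∧ A.scope s = r.vars)
        ⟨b, by rw [hab]; exact Finset.mem_insert_of_mem (Finset.mem_singleton_self _), hb⟩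
    rw [hab, Finset.mem_insert, Finset.mem_singleton] at this
    exact this.1.resolve_left fun he => hne (ha.symm.trans (he ▸ this.2))
  rw [hl, hr]
  exact ⟨fun he => hne (ha.symm.trans (he ▸ hb)), hab, ha, hb⟩

/-- Proved from the root of `V` downwards: a node with scope X_p is, or has as a child, a product
node with that scope, whose children have the scopes of the children of p. The aim is that every
latent variable has at least one value. -/
theorem exists_scope_eq {z : VTree ι} (hz : z ∈ V.nodes) : ∃ s : A.Node, A.scope s = z.vars := by
  refine VTree.nodes_induction (P := fun z => ∃ s : A.Node, A.scope s = z.vars)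
    ⟨A.root, hA.scope_root.trans hV.2.symm⟩ ?_ hz
  have key : ∀ l r, VTree.node l r ∈ V.nodes → (∃ s, A.scope s = (VTree.node l r).vars) →
      ∃ t, t ∈ A.prodNodes (.node l r) := by
    rintro l r h ⟨s, hs⟩
    rcases kind_of_scope_node hV.1 h hs with hk | hk
    · exact ⟨s, mem_prodNodes.mpr ⟨hk, hs⟩⟩
    · obtain ⟨c, hc⟩ := hA.children_nonempty_of_sum hk
      exact ⟨c, mem_prodNodes.mpr ⟨hA.alternating.1 s hk c hc,
        (hA.scope_of_mem_children_sum hk hc).trans hs⟩⟩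
  rintro p z hp ⟨y, rfl | rfl⟩ h
  · obtain ⟨t, ht⟩ := key _ _ hp h
    exact ⟨_, (hA.children_of_mem_prodNodes hV hp ht).2.2.1⟩
  · obtain ⟨t, ht⟩ := key _ _ hp h
    exact ⟨_, (hA.children_of_mem_prodNodes hV hp ht).2.2.2⟩

theorem prodNodes_nonempty {z : VTree ι} (hz : z ∈ V.inner) : (A.prodNodes z).Nonempty := by
  have hz' := VTree.mem_nodes_of_mem_inner hz
  obtain ⟨s, hs⟩ := hA.exists_scope_eq hV hz'
  cases z with
  | leaf i => exact absurd hz (V.leaf_notMem_inner i)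
  | node l r =>
    rcases kind_of_scope_node hV.1 hz' hs with hk | hk
    · exact ⟨s, mem_prodNodes.mpr ⟨hk, hs⟩⟩
    · obtain ⟨c, hc⟩ := hA.children_nonempty_of_sum hk
      exact ⟨c, mem_prodNodes.mpr ⟨hA.alternating.1 s hk c hc,
        (hA.scope_of_mem_children_sum hk hc).trans hs⟩⟩

/-- One step of the circuit recursion as a sum over the values of a latent variable, treating a
product root and a sum node alike. The function `val` is left open so that it can be the evaluation
or the constant 1. -/
theorem sum_edgeWeight_mul {val : A.Node → ℝ≥0}
    (hval : ∀ s, A.kind s = .sum → val s = ∑ c ∈ A.children s, A.weight s c * val c)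
    {s : A.Node} {l r : VTree ι} (h : VTree.node l r ∈ V.nodes)
    (hs : A.scope s = (VTree.node l r).vars) :
    ∑ t : {t // t ∈ A.prodNodes (.node l r)}, A.edgeWeight s t * val t = val s := by
  rw [Finset.sum_coe_sort (A.prodNodes (.node l r)) fun t => A.edgeWeight s t * val t]
  rcases kind_of_scope_node hV.1 h hs with hk | hk
  · rw [Finset.sum_eq_single_of_mem s (mem_prodNodes.mpr ⟨hk, hs⟩)]
    · simp [edgeWeight, hk, NodeKind.isProd]
    · intro t _ hts
      simp [edgeWeight, hk, NodeKind.isProd, hts]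
  · rw [hval s hk]
    -- By smoothness and alternation the children of `s` are among the values of the latent
    -- variable; the remaining values have edge weight 0.
    have hsub : A.children s ⊆ A.prodNodes (.node l r) := fun c hc =>
      mem_prodNodes.mpr ⟨hA.alternating.1 s hk c hc,
        (hA.scope_of_mem_children_sum hk hc).trans hs⟩
    rw [← Finset.sum_subset hsub]
    · refine Finset.sum_congr rfl fun c hc => ?_
      simp [edgeWeight, hk, NodeKind.isProd, hc]
    · intro c _ hc
      simp [edgeWeight, hk, NodeKind.isProd, hc]

end IsStructuredPC

end Structured

theorem governor_self {V : VTree ι} {C : Finset (VTree ι)} (c : A.Assign C) :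
    A.governor V c V = A.root := by
  have : Nonempty A.Node := ⟨A.root⟩
  have h : (V = V ∧ A.governor V c V = A.root) ∨ _ :=
    Classical.epsilon_spec (p := fun s => (V = V ∧ s = A.root) ∨
      (V ≠ V ∧ ∃ p : {p // p ∈ C}, p.1.IsParent V ∧ s ∈ A.children (c p) ∧ A.scope s = V.vars))
      ⟨A.root, Or.inl ⟨rfl, rfl⟩⟩
  exact h.elim (fun h => h.2) fun h => absurd rfl h.1

theorem governor_eq_childAt {V : VTree ι} (hV : V.LeavesDistinct) {C : Finset (VTree ι)}
    (hC : C ⊆ V.inner) (c : A.Assign C) {p z : VTree ι} (hp : p ∈ C) (hz : p.IsParent z) :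
    A.governor V c z = A.childAt (c ⟨p, hp⟩) z := by
  have hpV := VTree.mem_nodes_of_mem_inner (hC hp)
  have hzV := hz.ne_root hpV
  unfold governor childAt
  -- Both sides are choices by `epsilon`, so it suffices that the predicates coincide.
  congr 1
  funext s
  refine propext ⟨?_, fun h => Or.inr ⟨hzV, ⟨p, hp⟩, hz, h⟩⟩
  rintro (⟨h, -⟩ | ⟨-, ⟨q, hq⟩, hqz, h⟩)
  · exact absurd h hzV
  · obtain rfl := hV.parent_unique hpV (VTree.mem_nodes_of_mem_inner (hC hq)) hz hqz
    exact h

/-- The governor of `z` depends only on the value at the parent of `z`. -/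
theorem governor_congr {V : VTree ι} (hV : V.LeavesDistinct) {C D : Finset (VTree ι)}
    (hC : C ⊆ V.inner) (hD : D ⊆ V.inner) (c : A.Assign C) (d : A.Assign D) {z : VTree ι}
    (hz : z ∈ V.nodes)
    (h : ∀ p ∈ V.inner, p.IsParent z →
      ∃ (hpC : p ∈ C) (hpD : p ∈ D), (c ⟨p, hpC⟩ : A.Node) = d ⟨p, hpD⟩) :
    A.governor V c z = A.governor V d z := by
  rcases VTree.exists_parent hz with rfl | ⟨p, hp, hpz⟩
  · rw [governor_self, governor_self]
  · obtain ⟨hpC, hpD, he⟩ := h p (hpz.mem_inner hp) hpz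
    rw [governor_eq_childAt hV hC c hpC hpz, governor_eq_childAt hV hD d hpD hpz, he]

theorem IsStructuredPC.scope_governor [Fintype ι] [∀ i, MeasurableSpace (E i)]
    {μ : ∀ i, MeasureTheory.Measure (E i)} {V : VTree ι} (hA : A.IsStructuredPC μ V)
    (hV : V.IsVtree) {C : Finset (VTree ι)} (hC : C ⊆ V.inner) (c : A.Assign C) {z : VTree ι}
    (hz : z ∈ V.nodes) (h : ∀ p ∈ V.inner, p.IsParent z → p ∈ C) :
    A.scope (A.governor V c z) = z.vars := by
  rcases VTree.exists_parent hz with rfl | ⟨p, hp, hpz⟩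
  · rw [governor_self, hA.scope_root, hV.2]
  · have hpC := h p (hpz.mem_inner hp) hpz
    rw [governor_eq_childAt hV.1 hC c hpC hpz]
    obtain ⟨s, rfl | rfl⟩ := hpz
    · exact (hA.children_of_mem_prodNodes hV hp (c ⟨_, hpC⟩).2).2.2.1
    · exact (hA.children_of_mem_prodNodes hV hp (c ⟨_, hpC⟩).2).2.2.2

theorem latentCPT_eq {V : VTree ι} (a : A.Assign V.inner) (z : {z // z ∈ V.inner}) :
    A.latentCPT V a z = A.edgeWeight (A.governor V a z.1) (a z) := rfl

end Circuit

/-! ### The Bayesian network represents the circuit. -/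

namespace Circuit

variable {ι : Type u} {E : ι → Type v} [DecidableEq ι] {A : Circuit.{u, v, w} ι E}

theorem _root_.VTree.self_mem_inner (l r : VTree ι) : VTree.node l r ∈ (VTree.node l r).inner :=
  VTree.mem_inner_node.mpr (Or.inl rfl)

theorem _root_.VTree.inner_subset_left (l r : VTree ι) : l.inner ⊆ (VTree.node l r).inner :=
  fun _ h => VTree.mem_inner_node.mpr (Or.inr (Or.inl h))

theorem _root_.VTree.inner_subset_right (l r : VTree ι) : r.inner ⊆ (VTree.node l r).inner :=
  fun _ h => VTree.mem_inner_node.mpr (Or.inr (Or.inr h))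

/-- The part of the joint mass of the Bayesian network that belongs to the subtree `z`, when `s`
governs its root and a leaf variable governed by `s'` contributes `val s'`. -/
noncomputable def treeMass (A : Circuit.{u, v, w} ι E) (val : A.Node → ℝ≥0) :
    (z : VTree ι) → A.Node → A.Assign z.inner → ℝ≥0
  | .leaf _, s, _ => val s
  | .node l r, s, a =>
    A.edgeWeight s (a ⟨.node l r, VTree.self_mem_inner l r⟩) *
      (treeMass A val l (A.childAt (a ⟨.node l r, VTree.self_mem_inner l r⟩) l)
          (A.restrict (VTree.inner_subset_left l r) a) *
        treeMass A val r (A.childAt (a ⟨.node l r, VTree.self_mem_inner l r⟩) r)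
          (A.restrict (VTree.inner_subset_right l r) a))

/-- An assignment of the inner nodes of `node l r` is a value at the root together with
assignments of the inner nodes of `l` and of `r`. -/
theorem bijective_splitAssign {l r : VTree ι} (h : (VTree.node l r).LeavesDistinct) :
    Function.Bijective fun a : A.Assign (VTree.node l r).inner =>
      ((a ⟨.node l r, VTree.self_mem_inner l r⟩, A.restrict (VTree.inner_subset_left l r) a,
        A.restrict (VTree.inner_subset_right l r) a) :
        {t // t ∈ A.prodNodes (.node l r)} × A.Assign l.inner × A.Assign r.inner) := by
  constructor
  · intro a b hab
    simp only [Prod.mk.injEq] at hab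
    obtain ⟨h0, h1, h2⟩ := hab
    funext ⟨z, hz⟩
    rcases VTree.mem_inner_node.mp hz with rfl | hz' | hz'
    · exact h0
    · exact congrFun h1 ⟨z, hz'⟩
    · exact congrFun h2 ⟨z, hz'⟩
  · rintro ⟨t, b, c⟩
    have hroot := VTree.node_notMem_inner_union l r
    rw [Finset.mem_union, not_or] at hroot
    have hdisj := Finset.disjoint_left.mp h.disjoint_inner
    refine ⟨fun z => if hz : z.1 = .node l r then ⟨t, by rw [hz]; exact t.2⟩
      else if hl : z.1 ∈ l.inner then b ⟨z.1, hl⟩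
      else c ⟨z.1, ((VTree.mem_inner_node.mp z.2).resolve_left hz).resolve_left hl⟩, ?_⟩
    refine Prod.ext ?_ (Prod.ext ?_ ?_)
    · simp
    · funext ⟨z, hz⟩
      have hne : z ≠ .node l r := fun e => hroot.1 (e ▸ hz)
      simp [restrict, hz, hne]
    · funext ⟨z, hz⟩
      have hne : z ≠ .node l r := fun e => hroot.2 (e ▸ hz)
      have hl : z ∉ l.inner := fun hl => hdisj hl hz
      simp [restrict, hl, hne]

/-- The mass of a full assignment, split along the vtree. -/
theorem treeMass_governor {V : VTree ι} (hV : V.LeavesDistinct) (val : A.Node → ℝ≥0)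
    (a : A.Assign V.inner) {z : VTree ι} (hz : z ∈ V.nodes) :
    A.treeMass val z (A.governor V a z)
        (A.restrict (VTree.inner_subset_of_mem_nodes hz) a) =
      (∏ y ∈ z.inner, if h : y ∈ V.inner then A.latentCPT V a ⟨y, h⟩ else 1) *
        ∏ j ∈ z.vars, val (A.governor V a (.leaf j)) := by
  induction z with
  | leaf i => simp [treeMass, VTree.inner_leaf, VTree.vars]
  | node l r ihl ihr =>
    have hlr := VTree.children_mem_nodes hz
    have hin := VTree.node_mem_inner hz
    have hl := ihl hlr.1
    have hr := ihr hlr.2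
    rw [governor_eq_childAt hV subset_rfl a hin (VTree.isParent_left l r)] at hl
    rw [governor_eq_childAt hV subset_rfl a hin (VTree.isParent_right l r)] at hr
    -- The default factor 1 is never reached. It turns the conditional probability into a function
    -- on all vtree nodes, so that the product can be split at the root and the two subtrees.
    have hsplit : ∀ F : VTree ι → ℝ≥0, ∏ y ∈ (VTree.node l r).inner, F y =
        F (.node l r) * ((∏ y ∈ l.inner, F y) * ∏ y ∈ r.inner, F y) := fun F => by
      rw [VTree.inner_node, Finset.prod_insert (VTree.node_notMem_inner_union l r),
        Finset.prod_union (hV.of_mem_nodes hz).disjoint_inner]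
    rw [hsplit, dif_pos hin, VTree.vars, Finset.prod_union (hV.disjoint hz), latentCPT_eq]
    refine (congrArg₂ (fun p q => A.edgeWeight (A.governor V a (.node l r)) (a ⟨_, hin⟩) *
      (p * q)) hl hr).trans ?_
    ring

section Structured

variable [Fintype ι] [∀ i, MeasurableSpace (E i)] {μ : ∀ i, MeasureTheory.Measure (E i)}
  {V : VTree ι}

/-- Elimination of the latent variables from the bottom up: for a fixed value `t` at the root the
two subtrees sum independently to the values of the children of `t`, whose product is `val t`, and
the sum over `t` is one step of the sum node recursion. -/
theorem IsStructuredPC.sum_treeMass (hA : A.IsStructuredPC μ V) (hV : V.IsVtree)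
    {val : A.Node → ℝ≥0}
    (hsum : ∀ s, A.kind s = .sum → val s = ∑ c ∈ A.children s, A.weight s c * val c)
    (hprod : ∀ s, A.kind s = .prod → val s = ∏ c ∈ A.children s, val c)
    {z : VTree ι} (hz : z ∈ V.nodes) {s : A.Node} (hs : A.scope s = z.vars) :
    ∑ a : A.Assign z.inner, A.treeMass val z s a = val s := by
  induction z generalizing s with
  | leaf i =>
    have : IsEmpty {z // z ∈ (VTree.leaf i).inner} := ⟨fun z =>
      Finset.notMem_empty z.1 ((VTree.inner_leaf i).le z.2)⟩
    simp [treeMass]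
  | node l r ihl ihr =>
    have hlr := VTree.children_mem_nodes hz
    rw [← hA.sum_edgeWeight_mul hV hsum hz hs]
    refine (Fintype.sum_bijective _ (bijective_splitAssign (A := A) (hV.1.of_mem_nodes hz)) _
      (fun p : {t // t ∈ A.prodNodes (.node l r)} × A.Assign l.inner × A.Assign r.inner =>
        A.edgeWeight s p.1 * (A.treeMass val l (A.childAt p.1 l) p.2.1 *
          A.treeMass val r (A.childAt p.1 r) p.2.2)) fun a => rfl).trans ?_
    rw [Fintype.sum_prod_type]
    refine Finset.sum_congr rfl fun t _ => ?_
    obtain ⟨hne, hc, hl, hr⟩ := hA.children_of_mem_prodNodes hV hz t.2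
    dsimp only
    rw [← Finset.mul_sum, Fintype.sum_prod_type, hprod t (mem_prodNodes.mp t.2).1, hc,
      Finset.prod_pair hne, ← ihl hlr.1 hl, ← ihr hlr.2 hr, Finset.sum_mul_sum]

theorem IsStructuredPC.sum_latentJoint_mul (hA : A.IsStructuredPC μ V) (hV : V.IsVtree)
    {val : A.Node → ℝ≥0}
    (hsum : ∀ s, A.kind s = .sum → val s = ∑ c ∈ A.children s, A.weight s c * val c)
    (hprod : ∀ s, A.kind s = .prod → val s = ∏ c ∈ A.children s, val c) :
    ∑ a : A.Assign V.inner, A.latentJoint V a * ∏ j, val (A.governor V a (.leaf j)) =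
      val A.root := by
  rw [← hA.sum_treeMass hV hsum hprod V.mem_nodes_self (hA.scope_root.trans hV.2.symm)]
  refine Finset.sum_congr rfl fun a _ => ?_
  have h := treeMass_governor hV.1 val a V.mem_nodes_self
  rw [governor_self, hV.2] at h
  refine Eq.trans ?_ h.symm
  congr 1
  rw [latentJoint, ← Finset.prod_coe_sort V.inner]
  refine Finset.prod_congr rfl fun y _ => ?_
  rw [dif_pos y.2]

/-- The Bayesian network represents the function of the circuit. -/
theorem IsStructuredPC.sum_latentJoint_mul_eval (hA : A.IsStructuredPC μ V) (hV : V.IsVtree)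
    (x : ∀ i, E i) :
    ∑ a : A.Assign V.inner, A.latentJoint V a * ∏ j, A.eval x (A.governor V a (.leaf j)) =
      A.density x :=
  hA.sum_latentJoint_mul hV (fun _ hs => eval_sum hs x) fun _ hs => eval_prod hs x

theorem IsStructuredPC.sum_latentJoint (hA : A.IsStructuredPC μ V) (hV : V.IsVtree) :
    ∑ a : A.Assign V.inner, A.latentJoint V a = 1 := by
  -- The constant 1 satisfies both recursions because the weights of each sum node add up to 1.
  simpa using hA.sum_latentJoint_mul hV (val := fun _ => 1)
    (fun s hs => by simp [hA.isPC.sum_normalized s hs]) fun s _ => by simp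

end Structured

end Circuit

/-! ### Separation in the tree and the global Markov property. -/

/-- The map (a, b) ↦ (sw a b, sw b a) is an involution, so it reindexes the double sum over pairs.
-/
theorem Finset.sum_mul_sum_eq_of_swap {α R : Type*} [Fintype α] [CommSemiring R] (sw : α → α → α)
    (hsw : ∀ a b, sw (sw a b) (sw b a) = a) {f g f' g' : α → R}
    (h : ∀ a b, f a * g b = f' (sw a b) * g' (sw b a)) :
    (∑ a, f a) * ∑ b, g b = (∑ a, f' a) * ∑ b, g' b := by
  rw [Finset.sum_mul_sum, Finset.sum_mul_sum, ← Fintype.sum_prod_type',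
    ← Fintype.sum_prod_type']
  have hinv : Function.Involutive fun p : α × α => (sw p.1 p.2, sw p.2 p.1) := fun p =>
    Prod.ext (hsw p.1 p.2) (hsw p.2 p.1)
  exact Fintype.sum_bijective _ hinv.bijective _ _ fun p => h p.1 p.2

section Reach

variable {ι : Type u}

/-- The vertices that can be reached from the observed variables `S` without meeting `C`. -/
def reachAvoiding [DecidableEq ι] (V : VTree ι) (C : Finset (VTree ι)) (S : Finset ι) :
    Set (VTree ι) :=
  {z | ∃ s ∈ observed S, ∃ p : V.skeleton.Walk s z, ∀ y ∈ p.support, y ∉ C}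

variable [DecidableEq ι] {V : VTree ι} {C : Finset (VTree ι)} {S : Finset ι}

theorem notMem_of_mem_reachAvoiding {z : VTree ι} (h : z ∈ reachAvoiding V C S) : z ∉ C := by
  obtain ⟨s, -, p, hp⟩ := h
  exact hp z p.end_mem_support

theorem reachAvoiding_adj {y z : VTree ι} (h : y ∈ reachAvoiding V C S)
    (hyz : V.skeleton.Adj y z) (hz : z ∉ C) : z ∈ reachAvoiding V C S := by
  obtain ⟨s, hs, p, hp⟩ := h
  refine ⟨s, hs, p.concat hyz, fun t ht => ?_⟩
  rw [SimpleGraph.Walk.support_concat, List.mem_append,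
    List.mem_singleton] at ht
  rcases ht with ht | rfl
  · exact hp t ht
  · exact hz

theorem observed_subset_reachAvoiding (hC : C ⊆ V.inner) : observed S ⊆ reachAvoiding V C S := by
  rintro _ ⟨i, hi, rfl⟩
  refine ⟨_, ⟨i, hi, rfl⟩, .nil, fun y hy => ?_⟩
  rw [SimpleGraph.Walk.support_nil, List.mem_singleton] at hy
  exact hy ▸ fun h => V.leaf_notMem_inner i (hC h)

/-- Blocking speaks of paths and reachability of walks; removing the loops of a walk only shrinks
its support. -/
theorem Blocks.notMem_reachAvoiding {T : Set (VTree ι)}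
    (h : Blocks V.skeleton (C : Set (VTree ι)) (observed S) T) {t : VTree ι} (ht : t ∈ T) :
    t ∉ reachAvoiding V C S := by
  rintro ⟨s, hs, p, hp⟩
  obtain ⟨z, hz, hzC⟩ := h s hs t ht p.bypass p.bypass_isPath
  exact hp z (p.support_bypass_subset_support hz) hzC

theorem VTree.IsParent.adj {p z : VTree ι} (hp : p ∈ V.nodes) (h : p.IsParent z) :
    V.skeleton.Adj p z := by
  rw [VTree.skeleton, SimpleGraph.fromRel_adj]
  exact ⟨fun he => h.numLeaves_lt.ne (he ▸ rfl), Or.inl ⟨hp, h⟩⟩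

end Reach

namespace Circuit

variable {ι : Type u} {E : ι → Type v} [DecidableEq ι] {A : Circuit.{u, v, w} ι E}

open scoped Classical in
/-- `a` with the values on `R` replaced by those of `b`. -/
noncomputable def swapOn {C : Finset (VTree ι)} (R : Set (VTree ι)) (a b : A.Assign C) :
    A.Assign C :=
  fun z => if z.1 ∈ R then b z else a z

section Swap

variable {V : VTree ι} {C : Finset (VTree ι)} {S : Finset ι}

theorem swapOn_mem {D : Finset (VTree ι)} {R : Set (VTree ι)} {a b : A.Assign D}
    {z : {z // z ∈ D}} (h : z.1 ∈ R) : swapOn R a b z = b z := if_pos h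

theorem swapOn_notMem {D : Finset (VTree ι)} {R : Set (VTree ι)} {a b : A.Assign D}
    {z : {z // z ∈ D}} (h : z.1 ∉ R) : swapOn R a b z = a z := if_neg h

theorem swapOn_swapOn {D : Finset (VTree ι)} (R : Set (VTree ι)) (a b : A.Assign D) :
    swapOn R (swapOn R a b) (swapOn R b a) = a := by
  funext z
  by_cases h : z.1 ∈ R
  · rw [swapOn_mem h, swapOn_mem h]
  · rw [swapOn_notMem h, swapOn_notMem h]

variable (hV : V.LeavesDistinct) {a b : A.Assign V.inner}
  (hab : ∀ z (h : z ∈ V.inner), z ∈ C → a ⟨z, h⟩ = b ⟨z, h⟩)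
include hV

theorem governor_swapOn_of_notMem {R : Set (VTree ι)} {z : VTree ι} (hz : z ∈ V.nodes)
    (h : ∀ p ∈ V.inner, p.IsParent z → p ∉ R) :
    A.governor V (swapOn R a b) z = A.governor V a z :=
  governor_congr hV subset_rfl subset_rfl _ _ hz fun p hp hpz =>
    ⟨hp, hp, by rw [swapOn_notMem (h p hp hpz)]⟩

include hab

/-- Only the value at the parent matters. If `z` is in the reachable set and its parent is not, the
parent lies in `C`, where `a` and `b` agree, so the value is that of `b` in every case. -/
theorem governor_swapOn_of_mem {z : VTree ι} (hz : z ∈ V.nodes)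
    (h : z ∈ reachAvoiding V C S ∨ ∃ p ∈ V.inner, p.IsParent z ∧ p ∈ reachAvoiding V C S) :
    A.governor V (swapOn (reachAvoiding V C S) a b) z = A.governor V b z := by
  refine governor_congr hV subset_rfl subset_rfl _ _ hz fun p hp hpz => ⟨hp, hp, ?_⟩
  have hpV := VTree.mem_nodes_of_mem_inner hp
  by_cases hpR : p ∈ reachAvoiding V C S
  · rw [swapOn_mem hpR]
  · rw [swapOn_notMem hpR]
    rcases h with h | ⟨q, hq, hqz, hqR⟩
    · by_cases hpC : p ∈ C
      · rw [hab p hp hpC]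
      · exact absurd (reachAvoiding_adj h (hpz.adj hpV).symm hpC) hpR
    · exact absurd (hV.parent_unique (VTree.mem_nodes_of_mem_inner hq) hpV hqz hpz ▸ hqR) hpR

theorem latentCPT_swapOn_of_mem (z : {z // z ∈ V.inner})
    (h : z.1 ∈ reachAvoiding V C S ∨ ∃ p ∈ V.inner, p.IsParent z ∧ p ∈ reachAvoiding V C S) :
    A.latentCPT V (swapOn (reachAvoiding V C S) a b) z = A.latentCPT V b z := by
  rw [latentCPT_eq, latentCPT_eq,
    governor_swapOn_of_mem hV hab (VTree.mem_nodes_of_mem_inner z.2) h]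
  by_cases hz : z.1 ∈ reachAvoiding V C S
  · rw [swapOn_mem hz]
  · rw [swapOn_notMem hz]
    obtain ⟨p, hp, hpz, hpR⟩ := h.resolve_left hz
    by_cases hzC : z.1 ∈ C
    · rw [hab z.1 z.2 hzC]
    · exact absurd (reachAvoiding_adj hpR (hpz.adj (VTree.mem_nodes_of_mem_inner hp)) hzC) hz

/-- The identity holds factor by factor. If `z` or its parent is reachable, the two factors at `z`
trade places; otherwise both are unchanged. -/
theorem latentJoint_mul_swapOn :
    A.latentJoint V a * A.latentJoint V b =
      A.latentJoint V (swapOn (reachAvoiding V C S) a b) *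
        A.latentJoint V (swapOn (reachAvoiding V C S) b a) := by
  simp only [latentJoint]
  rw [← Finset.prod_mul_distrib, ← Finset.prod_mul_distrib]
  refine Finset.prod_congr rfl fun z _ => ?_
  have hz := VTree.mem_nodes_of_mem_inner z.2
  by_cases h : z.1 ∈ reachAvoiding V C S ∨
      ∃ p ∈ V.inner, p.IsParent z ∧ p ∈ reachAvoiding V C S
  · rw [latentCPT_swapOn_of_mem hV hab z h,
      latentCPT_swapOn_of_mem hV (fun z h hC => (hab z h hC).symm) z h, mul_comm]
  · rw [not_or] at h
    have hp : ∀ p ∈ V.inner, p.IsParent z.1 → p ∉ reachAvoiding V C S := fun p hp hpz hpR =>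
      h.2 ⟨p, hp, hpz, hpR⟩
    simp only [latentCPT_eq]
    rw [governor_swapOn_of_notMem hV hz hp, governor_swapOn_of_notMem hV hz hp,
      swapOn_notMem h.1, swapOn_notMem h.1]

end Swap

open scoped Classical in
/-- The joint mass of the event `p` of the latent variables and of the observed variables in `S`,
where a variable governed by `s` contributes `val s`. -/
noncomputable def mass (A : Circuit.{u, v, w} ι E) (V : VTree ι) (val : A.Node → ℝ≥0)
    (p : A.Assign V.inner → Prop) (S : Finset ι) : ℝ≥0 :=
  ∑ a : A.Assign V.inner,
    if p a then A.latentJoint V a * ∏ j ∈ S, val (A.governor V a (.leaf j)) else 0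

theorem mass_congr {V : VTree ι} {val : A.Node → ℝ≥0} {p q : A.Assign V.inner → Prop} {S : Finset ι}
    (h : ∀ a, p a ↔ q a) : A.mass V val p S = A.mass V val q S := by
  rw [funext fun a => propext (h a)]

/-- The global Markov property: given `C`, the variables `S` are independent of everything that
`C` blocks from them. -/
theorem mass_mul_mass [Fintype ι] {V : VTree ι} (hV : V.IsVtree) (val : A.Node → ℝ≥0)
    {C D : Finset (VTree ι)} (hC : C ⊆ V.inner) {S T : Finset ι} (hST : Disjoint S T)
    (hT : Blocks V.skeleton (C : Set (VTree ι)) (observed S) (observed T))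
    (hD : Blocks V.skeleton (C : Set (VTree ι)) (observed S) (D : Set (VTree ι)))
    (c : A.Assign C) {q : A.Assign V.inner → Prop}
    (hq : ∀ a b : A.Assign V.inner, (∀ z (h : z ∈ V.inner), z ∈ D → a ⟨z, h⟩ = b ⟨z, h⟩) →
      q a → q b) :
    A.mass V val (fun a => A.Agree a c) ∅ * A.mass V val (fun a => A.Agree a c ∧ q a) (S ∪ T) =
      A.mass V val (fun a => A.Agree a c) S * A.mass V val (fun a => A.Agree a c ∧ q a) T := by
  set R := reachAvoiding V C S with hR
  have hval : ∀ j : ι, VTree.leaf j ∈ V.nodes := fun j =>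
    VTree.leaf_mem_nodes (hV.2 ▸ Finset.mem_univ j)
  -- Neither event notices the exchange: the reachable set avoids `C` by construction and `D`
  -- because `C` blocks it.
  have hagree : ∀ a b : A.Assign V.inner, A.Agree (swapOn R a b) c ↔ A.Agree a c := fun a b => by
    refine forall_congr' fun z => forall_congr' fun hz => forall_congr' fun hzC => ?_
    rw [swapOn_notMem fun h => notMem_of_mem_reachAvoiding h hzC]
  have hqs : ∀ a b : A.Assign V.inner, q (swapOn R a b) ↔ q a := fun a b => by
    have : ∀ z (h : z ∈ V.inner), z ∈ D → swapOn R a b ⟨z, h⟩ = a ⟨z, h⟩ := fun z h hzD =>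
      swapOn_notMem (hD.notMem_reachAvoiding hzD)
    exact ⟨hq _ _ this, hq _ _ fun z h hzD => (this z h hzD).symm⟩
  refine Finset.sum_mul_sum_eq_of_swap (swapOn R) (swapOn_swapOn R) fun a b => ?_
  have hb' := and_congr (hagree b a) (hqs b a)
  by_cases ha : A.Agree a c
  swap
  · rw [if_neg ha, if_neg (mt (hagree a b).mp ha), zero_mul, zero_mul]
  by_cases hb : A.Agree b c ∧ q b
  swap
  · rw [if_neg hb, if_neg (mt hb'.mp hb), mul_zero, mul_zero]
  rw [if_pos ha, if_pos hb, if_pos ((hagree a b).mpr ha), if_pos (hb'.mpr hb)]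
  have hab : ∀ z (h : z ∈ V.inner), z ∈ C → a ⟨z, h⟩ = b ⟨z, h⟩ := fun z h hzC =>
    Subtype.ext ((ha z h hzC).trans (hb.1 z h hzC).symm)
  -- After the exchange the first assignment carries the factors of `b` on `S`, and the second still
  -- carries those of `b` on `T`. A reachable parent of a leaf in `T` would make the leaf reachable,
  -- as leaves are never in `C`.
  have h1 : ∀ j ∈ S, val (A.governor V (swapOn R a b) (.leaf j)) =
      val (A.governor V b (.leaf j)) := fun j hj => by
    rw [governor_swapOn_of_mem hV.1 hab (hval j)
      (Or.inl (observed_subset_reachAvoiding hC ⟨j, hj, rfl⟩))]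
  have h2 : ∀ j ∈ T, val (A.governor V (swapOn R b a) (.leaf j)) =
      val (A.governor V b (.leaf j)) := fun j hj => by
    rw [governor_swapOn_of_notMem hV.1 (hval j) fun p hp hpz hpR =>
      hT.notMem_reachAvoiding ⟨j, hj, rfl⟩ (reachAvoiding_adj hpR
        (hpz.adj (VTree.mem_nodes_of_mem_inner hp)) fun h => V.leaf_notMem_inner j (hC h))]
  rw [Finset.prod_congr rfl h1, Finset.prod_congr rfl h2, Finset.prod_union hST,
    Finset.prod_empty, mul_one]
  have := latentJoint_mul_swapOn (S := S) hV.1 hab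
  rw [← hR] at this
  calc _ = (A.latentJoint V a * A.latentJoint V b) *
        ((∏ j ∈ S, val (A.governor V b (.leaf j))) *
          ∏ j ∈ T, val (A.governor V b (.leaf j))) := by ring
    _ = _ := by rw [this]; ring

end Circuit

/-! ### Partial assignments and conditional probabilities. -/

namespace Circuit

variable {ι : Type u} {E : ι → Type v} [DecidableEq ι] {A : Circuit.{u, v, w} ι E}

section Assignments

variable {V : VTree ι} {C D : Finset (VTree ι)}

theorem Agree.symm {c : A.Assign C} {d : A.Assign D} (h : A.Agree c d) : A.Agree d c :=
  fun z hD hC => (h z hC hD).symm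

theorem exists_agree (hD : ∀ z ∈ D, (A.prodNodes z).Nonempty) (c : A.Assign C) :
    ∃ d : A.Assign D, A.Agree c d := by
  choose f hf using hD
  refine ⟨fun z => if h : z.1 ∈ C then c ⟨z.1, h⟩ else ⟨f z.1 z.2, hf z.1 z.2⟩, fun z hC hD => ?_⟩
  simp [hC]

theorem agree_iff_eq_restrict (h : D ⊆ C) (a : A.Assign C) (d : A.Assign D) :
    A.Agree a d ↔ d = A.restrict h a :=
  ⟨fun hd => funext fun z => Subtype.ext (hd z.1 (h z.2) z.2).symm,
    fun hd _ _ _ => hd ▸ rfl⟩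

theorem agree_of_agree {a : A.Assign V.inner} {c : A.Assign C} {d : A.Assign D}
    (hC : C ⊆ V.inner) (hc : A.Agree a c) (hd : A.Agree a d) : A.Agree c d :=
  fun z hzC hzD => (hc z (hC hzC) hzC).symm.trans (hd z (hC hzC) hzD)

theorem agree_union {a : A.Assign V.inner} (d : A.Assign (C ∪ D)) :
    A.Agree a d ↔ A.Agree a (A.restrict (Finset.subset_union_left (s₁ := C) (s₂ := D)) d) ∧
      A.Agree a (A.restrict (Finset.subset_union_right (s₁ := C) (s₂ := D)) d) := by
  refine ⟨fun h => ⟨fun z hz hC => h z hz (Finset.mem_union_left _ hC),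
    fun z hz hD => h z hz (Finset.mem_union_right _ hD)⟩, fun h z hz hCD => ?_⟩
  rcases Finset.mem_union.mp hCD with hC | hD
  · exact h.1 z hz hC
  · exact h.2 z hz hD

theorem Agree.congr {a b : A.Assign V.inner} {c : A.Assign C} (h : A.Agree a c)
    (hab : ∀ z (h : z ∈ V.inner), z ∈ C → a ⟨z, h⟩ = b ⟨z, h⟩) : A.Agree b c :=
  fun z hz hC => (hab z hz hC) ▸ h z hz hC

variable (val : A.Node → ℝ≥0)

theorem latentProb_self_eq_mass (c : A.Assign C) :
    A.latentProb V c c = A.mass V val (fun a => A.Agree a c) ∅ := by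
  classical
  simp only [latentProb, mass, Finset.prod_empty, mul_one]
  exact Finset.sum_congr rfl fun a _ => if_congr (and_self_iff) rfl rfl

theorem latentProb_eq_mass (c : A.Assign C) (d : A.Assign D) :
    A.latentProb V c d = A.mass V val (fun a => A.Agree a c ∧ A.Agree a d) ∅ := by
  classical
  simp only [latentProb, mass, Finset.prod_empty, mul_one]
  refine Finset.sum_congr rfl fun a _ => ?_
  congr

variable {val}

theorem mass_eq_zero {p q : A.Assign V.inner → Prop} (hp : A.mass V val p ∅ = 0)
    (hq : ∀ a, q a → p a) (S : Finset ι) : A.mass V val q S = 0 := by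
  refine Finset.sum_eq_zero fun a _ => ?_
  split_ifs with ha
  · have := (Finset.sum_eq_zero_iff.mp hp) a (Finset.mem_univ a)
    rw [if_pos (hq a ha), Finset.prod_empty, mul_one] at this
    rw [this, zero_mul]
  · rfl

-- The law of total probability: a full assignment agrees with exactly one `d`, its restriction, and
-- a `d` that disagrees with `c` describes an empty event.
open scoped Classical in
theorem sum_mass_agree (hC : C ⊆ V.inner) (hD : D ⊆ V.inner) (c : A.Assign C) (S : Finset ι) :
    ∑ d ∈ Finset.univ.filter (fun d : A.Assign D => A.Agree c d),
      A.mass V val (fun a => A.Agree a c ∧ A.Agree a d) S =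
        A.mass V val (fun a => A.Agree a c) S := by
  rw [Finset.sum_filter_of_ne]
  · simp only [mass]
    rw [Finset.sum_comm]
    refine Finset.sum_congr rfl fun a _ => ?_
    by_cases ha : A.Agree a c
    · simp [ha, agree_iff_eq_restrict hD]
    · simp [ha]
  · intro d _ hd
    by_contra h
    refine hd (Finset.sum_eq_zero fun a _ => if_neg fun ha => h (agree_of_agree hC ha.1 ha.2))

-- For a null event the weights are uniform, and their sum is 1 only because some `d` agrees with
-- `c`; this is where nonempty value sets are needed.
open scoped Classical in
theorem sum_latentCond (hC : C ⊆ V.inner) (hD : D ⊆ V.inner)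
    (hne : ∀ z ∈ D, (A.prodNodes z).Nonempty) (c : A.Assign C) :
    ∑ d ∈ Finset.univ.filter (fun d : A.Assign D => A.Agree c d), A.latentCond V c d = 1 := by
  by_cases h : A.latentProb V c c = 0
  · simp only [latentCond, h, if_true, Finset.sum_const, nsmul_eq_mul]
    refine mul_inv_cancel₀ (Nat.cast_ne_zero.mpr (Finset.card_ne_zero.mpr ?_))
    obtain ⟨d, hd⟩ := exists_agree hne c
    exact ⟨d, Finset.mem_filter.mpr ⟨Finset.mem_univ d, hd⟩⟩
  · simp only [latentCond, h, if_false]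
    rw [← Finset.sum_div]
    refine (div_eq_one_iff_eq h).mpr ?_
    rw [latentProb_self_eq_mass 1]
    simp only [latentProb_eq_mass 1]
    exact sum_mass_agree hC hD c ∅

theorem latentProb_mul_latentCond (c : A.Assign C) (d : A.Assign D) :
    A.latentProb V c c * A.latentCond V c d = A.latentProb V c d ∨ A.latentProb V c c = 0 := by
  by_cases h : A.latentProb V c c = 0
  · exact Or.inr h
  · left
    rw [latentCond, if_neg h, mul_div_cancel₀ _ h]

end Assignments

/-! ### The restructured circuit: nodes, scopes, reachability. -/

section Restructure

variable {V W : VTree ι} {C : VTree ι → Finset (VTree ι)}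

/-- The node representing `p(X_z | C_z = c)`. -/
abbrev vecNode (C : VTree ι → Finset (VTree ι)) {z : VTree ι} (hz : z ∈ W.nodes)
    (c : A.Assign (C z)) : A.RNode W C :=
  .inl ⟨⟨z, hz⟩, c⟩

/-- The product node with index `d` at the inner node with children `l`, `r`. -/
abbrev layerNode (C : VTree ι → Finset (VTree ι)) {l r : VTree ι} (h : .node l r ∈ W.nodes)
    (d : A.Assign (C l ∪ C r)) : A.RNode W C :=
  .inr ⟨⟨.node l r, VTree.node_mem_inner h⟩, d⟩

theorem RNode.cases {P : A.RNode W C → Prop}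
    (leaf : ∀ i (h : .leaf i ∈ W.nodes) c, P (vecNode C h c))
    (node : ∀ l r (h : .node l r ∈ W.nodes) c, P (vecNode C h c))
    (layer : ∀ l r (h : .node l r ∈ W.nodes) d, P (layerNode C h d)) (t : A.RNode W C) : P t := by
  rcases t with ⟨⟨z, hz⟩, c⟩ | ⟨⟨z, hz⟩, d⟩
  · cases z with
    | leaf i => exact leaf i hz c
    | node l r => exact node l r hz c
  · cases z with
    | leaf i => exact absurd hz (W.leaf_notMem_inner i)
    | node l r => exact layer l r (VTree.mem_nodes_of_mem_inner hz) d

theorem layerNode_injective {l r : VTree ι} (h : .node l r ∈ W.nodes) :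
    Function.Injective (layerNode (A := A) C h) := fun _ _ hde =>
  eq_of_heq (Sigma.mk.inj (Sum.inr.inj hde)).2

open scoped Classical in
theorem rchildren_vecNode {l r : VTree ι} (h : .node l r ∈ W.nodes) (c : A.Assign (C (.node l r))) :
    A.rchildren W C (vecNode C h c) =
      (Finset.univ.filter fun d : A.Assign (C l ∪ C r) => A.Agree c d).image (layerNode C h) := rfl

theorem mem_rchildren_vecNode {l r : VTree ι} (h : .node l r ∈ W.nodes)
    (c : A.Assign (C (.node l r))) (t : A.RNode W C) :
    t ∈ A.rchildren W C (vecNode C h c) ↔ ∃ d, A.Agree c d ∧ layerNode C h d = t := by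
  classical
  rw [rchildren_vecNode, Finset.mem_image]
  simp only [Finset.mem_filter, Finset.mem_univ, true_and]

open scoped Classical in
theorem rchildren_layerNode {l r : VTree ι} (h : .node l r ∈ W.nodes) (d : A.Assign (C l ∪ C r)) :
    A.rchildren W C (layerNode C h d) =
      {vecNode C (VTree.children_mem_nodes h).1 (A.restrict Finset.subset_union_left d),
        vecNode C (VTree.children_mem_nodes h).2 (A.restrict Finset.subset_union_right d)} := rfl

theorem mem_rchildren_layerNode {l r : VTree ι} (h : .node l r ∈ W.nodes)
    (d : A.Assign (C l ∪ C r)) (t : A.RNode W C) :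
    t ∈ A.rchildren W C (layerNode C h d) ↔
      t = vecNode C (VTree.children_mem_nodes h).1 (A.restrict Finset.subset_union_left d) ∨
        t = vecNode C (VTree.children_mem_nodes h).2 (A.restrict Finset.subset_union_right d) := by
  classical
  rw [rchildren_layerNode, Finset.mem_insert, Finset.mem_singleton]

theorem biUnion_rchildren_layerNode {l r : VTree ι} (h : .node l r ∈ W.nodes)
    (d : A.Assign (C l ∪ C r)) (F : A.RNode W C → Finset ι) :
    (A.rchildren W C (layerNode C h d)).biUnion F =
      F (vecNode C (VTree.children_mem_nodes h).1 (A.restrict Finset.subset_union_left d)) ∪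
        F (vecNode C (VTree.children_mem_nodes h).2 (A.restrict Finset.subset_union_right d)) := by
  classical
  rw [rchildren_layerNode, Finset.biUnion_insert, Finset.singleton_biUnion]

open scoped Classical in
theorem sum_rchildren_vecNode {R : Type*} [AddCommMonoid R] {l r : VTree ι}
    (h : .node l r ∈ W.nodes) (c : A.Assign (C (.node l r))) (F : A.RNode W C → R) :
    ∑ t ∈ A.rchildren W C (vecNode C h c), F t =
      ∑ d ∈ Finset.univ.filter (fun d : A.Assign (C l ∪ C r) => A.Agree c d),
        F (layerNode C h d) := by
  rw [rchildren_vecNode, Finset.sum_image fun d _ e _ hde => layerNode_injective h hde]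

/-- The nodes sit at different vertices of `W`. Without this the pair of children of a product node
could collapse to one element. -/
theorem vecNode_ne {l r : VTree ι} (hW : W.LeavesDistinct) (h : .node l r ∈ W.nodes)
    (c : A.Assign (C l)) (d : A.Assign (C r)) :
    vecNode C (VTree.children_mem_nodes h).1 c ≠ vecNode C (VTree.children_mem_nodes h).2 d := by
  intro he
  have := congrArg (fun t : A.RNode W C => t.elim (fun y => y.1.1) fun y => y.1.1) he
  exact hW.ne h this

theorem childLabel_subset [Fintype ι] (hC : ValidLabelling V W C) {l r : VTree ι}
    (h : .node l r ∈ W.nodes) : C l ∪ C r ⊆ V.inner :=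
  Finset.union_subset (hC.latent _ (VTree.children_mem_nodes h).1)
    (hC.latent _ (VTree.children_mem_nodes h).2)

variable [Fintype ι] [∀ i, MeasurableSpace (E i)] {μ : ∀ i, MeasureTheory.Measure (E i)}
  (hV : V.IsVtree) (hW : W.IsVtree) (hA : A.IsStructuredPC μ V) (hC : ValidLabelling V W C)
include hV hA hC

/-- The label of a leaf contains its parent in the network, if there is one, so the governor has
scope {i} and must be a leaf node. -/
theorem exists_rkind_leaf {i : ι} (h : .leaf i ∈ W.nodes) (c : A.Assign (C (.leaf i))) :
    ∃ f, A.kind (A.governor V c (.leaf i)) = .leaf i f :=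
  hA.kind_of_scope_singleton hV <| hA.scope_governor hV (hC.latent _ h) c
    (VTree.leaf_mem_nodes (hV.2 ▸ Finset.mem_univ i)) fun p hp hpz => (hC.leaf i p).mpr ⟨hp, hpz⟩

theorem prodNodes_nonempty_of_label {z : VTree ι} (hz : z ∈ W.nodes) :
    ∀ y ∈ C z, (A.prodNodes y).Nonempty := fun _ hy =>
  hA.prodNodes_nonempty hV (hC.latent z hz hy)

theorem prodNodes_nonempty_of_childLabel {l r : VTree ι} (h : .node l r ∈ W.nodes) :
    ∀ y ∈ C l ∪ C r, (A.prodNodes y).Nonempty := fun y hy => by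
  have hlr := VTree.children_mem_nodes h
  rcases Finset.mem_union.mp hy with hy | hy
  · exact prodNodes_nonempty_of_label hV hA hC hlr.1 y hy
  · exact prodNodes_nonempty_of_label hV hA hC hlr.2 y hy

theorem scope_vecNode {z : VTree ι} (hz : z ∈ W.nodes) (c : A.Assign (C z)) :
    (A.restructure V W C hC.root).scope (vecNode C hz c) = z.vars := by
  classical
  induction z with
  | leaf i =>
    obtain ⟨f, hf⟩ := exists_rkind_leaf hV hA hC hz c
    exact scope_leaf (A := A.restructure V W C hC.root) (t := vecNode C hz c) hf
  | node l r ihl ihr =>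
    have hlr := VTree.children_mem_nodes hz
    refine (scope_sum (A := A.restructure V W C hC.root) (t := vecNode C hz c) rfl).trans ?_
    have key : ∀ d, (A.restructure V W C hC.root).scope (layerNode C hz d) =
        (VTree.node l r).vars := fun d => by
      refine (scope_prod (A := A.restructure V W C hC.root) (t := layerNode C hz d) rfl).trans ?_
      refine (biUnion_rchildren_layerNode hz d _).trans ?_
      rw [ihl hlr.1, ihr hlr.2, VTree.vars]
    ext i
    rw [Finset.mem_biUnion]
    constructor
    · rintro ⟨t, ht, hi⟩
      obtain ⟨d, -, rfl⟩ := (mem_rchildren_vecNode hz c t).mp ht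
      rwa [key] at hi
    · intro hi
      -- The scope of a sum node without children would be empty, so an agreeing `d` has to be
      -- produced.
      obtain ⟨d, hd⟩ := exists_agree (prodNodes_nonempty_of_childLabel hV hA hC hz) c
      exact ⟨layerNode C hz d, (mem_rchildren_vecNode hz c _).mpr ⟨d, hd, rfl⟩, by rwa [key]⟩

theorem scope_layerNode {l r : VTree ι} (h : .node l r ∈ W.nodes) (d : A.Assign (C l ∪ C r)) :
    (A.restructure V W C hC.root).scope (layerNode C h d) = (VTree.node l r).vars := by
  classical
  refine (scope_prod (A := A.restructure V W C hC.root) (t := layerNode C h d) rfl).trans ?_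
  refine (biUnion_rchildren_layerNode h d _).trans ?_
  rw [scope_vecNode hV hA hC, scope_vecNode hV hA hC, VTree.vars]

theorem reachable_layerNode {l r : VTree ι} (h : .node l r ∈ W.nodes) {t : A.RNode W C}
    (ht : ∀ c, Relation.ReflTransGen (fun a b => b ∈ A.rchildren W C a) t (vecNode C h c))
    (d : A.Assign (C l ∪ C r)) :
    Relation.ReflTransGen (fun a b => b ∈ A.rchildren W C a) t (layerNode C h d) := by
  obtain ⟨c, hc⟩ := exists_agree (prodNodes_nonempty_of_label hV hA hC h) d
  exact (ht c).tail ((mem_rchildren_vecNode h c _).mpr ⟨d, hc.symm, rfl⟩)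

/-- From the root of `W` downwards: every value of C_l or C_r extends to a value `d` of C_l ∪ C_r,
and every such `d` agrees with some value of C_w. -/
theorem reachable_vecNode {z : VTree ι} (hz : z ∈ W.nodes) (c : A.Assign (C z)) :
    Relation.ReflTransGen (fun a b => b ∈ A.rchildren W C a)
      (A.restructure V W C hC.root).root (vecNode C hz c) := by
  classical
  refine VTree.nodes_induction (P := fun z => ∀ (hz : z ∈ W.nodes) (c : A.Assign (C z)),
    Relation.ReflTransGen (fun a b => b ∈ A.rchildren W C a)
      (A.restructure V W C hC.root).root (vecNode C hz c)) ?_ ?_ hz hz c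
  · intro hz c
    refine (congrArg (Relation.ReflTransGen _ (A.restructure V W C hC.root).root)
      (congrArg (vecNode C hz) ?_)).mp .refl
    -- There is only one assignment of the empty label.
    funext y
    exact absurd y.2 (Finset.eq_empty_iff_forall_notMem.mp hC.root y.1)
  · rintro p z hp ⟨s, rfl | rfl⟩ ih hz c
    all_goals
      obtain ⟨d, hd⟩ := exists_agree (prodNodes_nonempty_of_childLabel hV hA hC hp) c
      refine (reachable_layerNode hV hA hC hp (ih hp) d).tail ?_
      rw [rchildren_layerNode]
    · have hc : c = A.restrict Finset.subset_union_left d :=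
        (agree_iff_eq_restrict _ _ _).mp hd.symm
      rw [hc]
      exact Finset.mem_insert_self _ _
    · have hc : c = A.restrict Finset.subset_union_right d :=
        (agree_iff_eq_restrict _ _ _).mp hd.symm
      rw [hc]
      exact Finset.mem_insert_of_mem (Finset.mem_singleton_self _)

theorem isPC_restructure : (A.restructure V W C hC.root).IsPC μ where
  leaf_no_children := by
    refine RNode.cases (fun i h c _ _ _ => rfl) ?_ ?_
    · intro l r h c i f hk
      cases hk
    · intro l r h d i f hk
      cases hk
  leaf_measurable := by
    refine RNode.cases (fun i h c j f hk => hA.isPC.leaf_measurable _ j f hk) ?_ ?_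
    · intro l r h c i f hk
      cases hk
    · intro l r h d i f hk
      cases hk
  leaf_normalized := by
    refine RNode.cases (fun i h c j f hk => hA.isPC.leaf_normalized _ j f hk) ?_ ?_
    · intro l r h c i f hk
      cases hk
    · intro l r h d i f hk
      cases hk
  sum_normalized := by
    classical
    refine RNode.cases ?_ ?_ ?_
    · intro i h c hk
      obtain ⟨f, hf⟩ := exists_rkind_leaf hV hA hC h c
      exact absurd (hf.symm.trans hk) (by simp)
    · intro l r h c _
      refine (sum_rchildren_vecNode h c (A.rweight V W C (vecNode C h c))).trans ?_
      exact sum_latentCond (hC.latent _ h) (childLabel_subset hC h)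
        (prodNodes_nonempty_of_childLabel hV hA hC h) c
    · intro l r h d hk
      cases hk
  rooted := by
    refine RNode.cases (fun i h c => reachable_vecNode hV hA hC h c)
      (fun l r h c => reachable_vecNode hV hA hC h c) fun l r h d => ?_
    exact reachable_layerNode hV hA hC h (reachable_vecNode hV hA hC h) d

end Restructure

end Circuit

/-! ### Bounds on hidden state size, number of edges and label size. -/

namespace Circuit

variable {ι : Type u} {E : ι → Type v} [DecidableEq ι] {A : Circuit.{u, v, w} ι E}
  {V W : VTree ι} {C : VTree ι → Finset (VTree ι)}

/-- Each variable in `D` has at most h values. Positivity of h is needed to enlarge the exponent. -/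
theorem card_assign_le [Fintype ι] {D : Finset (VTree ι)} (hD : D ⊆ V.inner)
    (hpos : 1 ≤ A.hiddenSize V) {m : ℕ} (hm : D.card ≤ m) :
    Fintype.card (A.Assign D) ≤ A.hiddenSize V ^ m := by
  refine le_trans ?_ (Nat.pow_le_pow_right hpos hm)
  rw [Fintype.card_pi]
  refine (Finset.prod_le_prod' (g := fun _ => A.hiddenSize V) fun z _ => ?_).trans ?_
  · rw [Fintype.card_coe]
    exact Finset.le_sup (f := fun z => (A.prodNodes z).card)
      (VTree.mem_nodes_of_mem_inner (hD z.2))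
  · simp

open scoped Classical in
/-- Pairs of agreeing assignments of `C` and `D` are assignments of `D ∪ C`. -/
theorem sum_card_agree_le {C D : Finset (VTree ι)} :
    ∑ c : A.Assign C, (Finset.univ.filter fun d : A.Assign D => A.Agree c d).card ≤
      Fintype.card (A.Assign (D ∪ C)) := by
  rw [← Finset.card_sigma, ← Finset.card_univ]
  refine Finset.card_le_card_of_surjOn (fun a : A.Assign (D ∪ C) =>
    (⟨A.restrict Finset.subset_union_right a, A.restrict Finset.subset_union_left a⟩ :
      Σ _ : A.Assign C, A.Assign D)) ?_
  rintro ⟨c, d⟩ hcd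
  have hcd' : A.Agree c d := by simpa using hcd
  refine ⟨fun z => if h : z.1 ∈ D then d ⟨z.1, h⟩ else
    c ⟨z.1, (Finset.mem_union.mp z.2).resolve_left h⟩, Finset.mem_coe.mpr (Finset.mem_univ _), ?_⟩
  refine Sigma.ext (funext fun z => ?_) (heq_of_eq (funext fun z => ?_))
  · by_cases h : z.1 ∈ D
    · simp only [restrict, h, dif_pos]
      exact Subtype.ext (hcd' z.1 z.2 h).symm
    · simp [restrict, h]
  · simp [restrict]

section Bounds

variable [Fintype ι] [∀ i, MeasurableSpace (E i)] {μ : ∀ i, MeasureTheory.Measure (E i)}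

/-- An inner node in `W` forces at least two variables, so the root of `V` is inner and has a
product node. -/
theorem IsStructuredPC.one_le_hiddenSize (hA : A.IsStructuredPC μ V) (hV : V.IsVtree)
    (hW : W.IsVtree) {z : VTree ι} (hz : z ∈ W.inner) : 1 ≤ A.hiddenSize V := by
  cases hVc : V with
  | leaf i =>
    have h := Finset.card_pos.mpr ⟨z, hz⟩
    have h' := hW.1.card_inner_lt
    rw [hW.2, ← hV.2, hVc, VTree.vars, Finset.card_singleton] at h'
    omega
  | node l r =>
    have h : V ∈ V.inner := Finset.mem_filter.mpr ⟨V.mem_nodes_self, by rw [hVc]; rfl⟩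
    rw [← hVc]
    exact (hA.prodNodes_nonempty hV h).card_pos.trans_le
      (Finset.le_sup (f := fun z => (A.prodNodes z).card) V.mem_nodes_self)

variable (hV : V.IsVtree) (hW : W.IsVtree) (hA : A.IsStructuredPC μ V)
  (hC : ValidLabelling V W C)
include hV hW hA hC

/-- Distinct nodes of `W` have distinct variable sets, so the product nodes with scope X_z form the
single layer built at `z`, indexed by the values of C_l ∪ C_r. -/
theorem hiddenSize_restructure_le :
    (A.restructure V W C hC.root).hiddenSize W ≤ A.hiddenSize V ^ childCardinality W C := by
  classical
  refine Finset.sup_le fun z hz => ?_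
  have hsub : ∀ t : A.RNode W C, t ∈ (A.restructure V W C hC.root).prodNodes z →
      ∃ (l r : VTree ι) (h : .node l r ∈ W.nodes) (d : A.Assign (C l ∪ C r)),
        z = .node l r ∧ t = layerNode C h d := by
    refine RNode.cases ?_ ?_ ?_
    · intro i h c ht
      obtain ⟨f, hf⟩ := exists_rkind_leaf hV hA hC h c
      exact absurd (hf.symm.trans (mem_prodNodes.mp ht).1) (by simp)
    · intro l r h c ht
      cases (mem_prodNodes.mp ht).1
    · intro l r h d ht
      have hs := (mem_prodNodes.mp ht).2
      rw [scope_layerNode hV hA hC] at hs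
      exact ⟨l, r, h, d, (hW.1.eq_of_vars_eq h hz hs).symm, rfl⟩
  cases z with
  | leaf i =>
    rw [Finset.eq_empty_of_forall_notMem (s := (A.restructure V W C hC.root).prodNodes (.leaf i))
      fun t ht => ?_]
    · exact Nat.zero_le _
    · obtain ⟨l, r, h, d, he, -⟩ := hsub t ht
      cases he
  | node l r =>
    have hin := VTree.node_mem_inner hz
    refine le_trans ?_ (card_assign_le (childLabel_subset hC hz)
      (hA.one_le_hiddenSize hV hW hin) (Finset.le_sup (f := fun z => (childLabel C z).card) hin))
    rw [← Finset.card_univ]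
    refine Finset.card_le_card_of_surjOn (layerNode C hz) fun t ht => ?_
    obtain ⟨l', r', h, d, he, rfl⟩ := hsub t ht
    cases he
    exact ⟨d, Finset.mem_coe.mpr (Finset.mem_univ _), rfl⟩

/-- The constant 3 counts, per inner node of `W`, one h^M' for the edges leaving sum nodes and two
for the edges leaving product nodes. Edges of the first kind are agreeing pairs (c, d), that is,
values of C_l ∪ C_r ∪ C_w. -/
theorem size_restructure_le :
    (A.restructure V W C hC.root).size ≤
      3 * (Fintype.card ι * A.hiddenSize V ^ labelCardinality W C) := by
  classical
  set B := A.hiddenSize V ^ labelCardinality W C with hB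
  have hcard : W.inner.card ≤ Fintype.card ι := by
    have := hW.1.card_inner_lt
    rw [hW.2, Finset.card_univ] at this
    exact this.le
  have h1 : ∀ z : {z // z ∈ W.nodes}, ∑ c : A.Assign (C z.1), (A.rchildren W C (.inl ⟨z, c⟩)).card
      ≤ if z.1.isInner = true then B else 0 := by
    rintro ⟨z, hz⟩
    cases z with
    | leaf i => simp [rchildren]
    | node l r =>
      have hin := VTree.node_mem_inner hz
      refine le_trans (le_of_eq (Finset.sum_congr rfl fun c _ => ?_)) ((sum_card_agree_le
        (C := C (.node l r)) (D := C l ∪ C r)).trans (card_assign_le (m := labelCardinality W C)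
        (Finset.union_subset (childLabel_subset hC hz) (hC.latent _ hz))
        (hA.one_le_hiddenSize hV hW hin)
        (Finset.le_sup (f := fun z => (childLabel C z ∪ C z).card) hin)))
      refine (congrArg Finset.card (rchildren_vecNode hz c)).trans ?_
      rw [Finset.card_image_of_injective _ (layerNode_injective hz)]
  have h2 : ∀ z : {z // z ∈ W.inner},
      ∑ d : A.Assign (childLabel C z.1), (A.rchildren W C (.inr ⟨z, d⟩)).card ≤ 2 * B := by
    rintro ⟨z, hz⟩
    cases z with
    | leaf i => exact absurd hz (W.leaf_notMem_inner i)
    | node l r =>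
      have hz' := VTree.mem_nodes_of_mem_inner hz
      refine (Finset.sum_le_card_nsmul _ _ 2 fun d _ => ?_).trans ?_
      · refine (congrArg Finset.card (rchildren_layerNode hz' d)).trans_le ?_
        exact Finset.card_le_two
      · rw [smul_eq_mul, mul_comm, Finset.card_univ]
        refine Nat.mul_le_mul_left 2 (card_assign_le (childLabel_subset hC hz')
          (hA.one_le_hiddenSize hV hW hz) ?_)
        exact (Finset.card_le_card Finset.subset_union_left).trans
          (Finset.le_sup (f := fun z => (childLabel C z ∪ C z).card) hz)
  have hsize : (A.restructure V W C hC.root).size =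
      ∑ t : A.RNode W C, (A.rchildren W C t).card := rfl
  rw [hsize, Fintype.sum_sum_type, Fintype.sum_sigma, Fintype.sum_sigma]
  have h3 : ∑ z : {z // z ∈ W.nodes}, (if z.1.isInner = true then B else 0) =
      W.inner.card * B := by
    rw [Finset.sum_coe_sort W.nodes fun z => if z.isInner = true then B else 0,
      ← Finset.sum_filter, Finset.sum_const, smul_eq_mul]
    rfl
  calc _ ≤ W.inner.card * B + W.inner.card * (2 * B) := by
        refine Nat.add_le_add ((Finset.sum_le_sum fun z _ => h1 z).trans h3.le) ?_
        refine (Finset.sum_le_card_nsmul _ _ (2 * B) fun z _ => h2 z).trans (le_of_eq ?_)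
        rw [smul_eq_mul, Finset.card_univ, Fintype.card_coe]
    _ = 3 * (W.inner.card * B) := by ring
    _ ≤ _ := Nat.mul_le_mul_left 3 (Nat.mul_le_mul_right B hcard)

end Bounds

/-- C_w is contained in the child label of the parent of w, and is empty at the root, so it adds at
most M further elements. -/
theorem labelCardinality_le [Fintype ι] (hC : ValidLabelling V W C) :
    labelCardinality W C ≤ 2 * childCardinality W C := by
  refine Finset.sup_le fun z hz => ?_
  have h1 : (childLabel C z).card ≤ childCardinality W C :=
    Finset.le_sup (f := fun z => (childLabel C z).card) hz
  have h2 : (C z).card ≤ childCardinality W C := by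
    rcases VTree.exists_parent (VTree.mem_nodes_of_mem_inner hz) with rfl | ⟨p, hp, hpz⟩
    · rw [hC.root, Finset.card_empty]
      exact Nat.zero_le _
    · refine le_trans (Finset.card_le_card ?_)
        (Finset.le_sup (f := fun z => (childLabel C z).card) (hpz.mem_inner hp))
      obtain ⟨s, rfl | rfl⟩ := hpz
      · exact Finset.subset_union_left
      · exact Finset.subset_union_right
  exact (Finset.card_union_le _ _).trans (by omega)

/-- Given `C_l ∪ C_r`, the variables of the children of an inner node are independent. -/
theorem mass_agree_union [Fintype ι] (hV : V.IsVtree) (hW : W.IsVtree)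
    (hC : ValidLabelling V W C) {l r : VTree ι} (h : .node l r ∈ W.nodes) (val : A.Node → ℝ≥0)
    (c : A.Assign (C (.node l r))) (d : A.Assign (C l ∪ C r)) :
    A.mass V val (fun a => A.Agree a (A.restrict (Finset.subset_union_left (s₂ := C r)) d)) ∅ *
        (A.mass V val (fun a => A.Agree a (A.restrict (Finset.subset_union_right (s₁ := C l)) d))
            ∅ *
          A.mass V val (fun a => A.Agree a c ∧ A.Agree a d) (l.vars ∪ r.vars)) =
      A.mass V val (fun a => A.Agree a (A.restrict (Finset.subset_union_left (s₂ := C r)) d))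
          l.vars *
        (A.mass V val (fun a => A.Agree a (A.restrict (Finset.subset_union_right (s₁ := C l)) d))
            r.vars *
          A.mass V val (fun a => A.Agree a c ∧ A.Agree a d) ∅) := by
  obtain ⟨hl, hr⟩ := VTree.children_mem_nodes h
  set dl := A.restrict (Finset.subset_union_left (s₂ := C r)) d
  set dr := A.restrict (Finset.subset_union_right (s₁ := C l)) d
  have hdisj := hW.1.disjoint h
  have e1 : ∀ a : A.Assign V.inner, (A.Agree a c ∧ A.Agree a d) ↔
      (A.Agree a dl ∧ (A.Agree a dr ∧ A.Agree a c)) := fun a => by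
    rw [agree_union d]
    tauto
  have e2 : ∀ a : A.Assign V.inner, (A.Agree a c ∧ A.Agree a d) ↔
      (A.Agree a dr ∧ (A.Agree a dl ∧ A.Agree a c)) := fun a => by
    rw [agree_union d]
    tauto
  have hq : ∀ {X : Finset (VTree ι)} (e : A.Assign X) (a b : A.Assign V.inner),
      (∀ z (h : z ∈ V.inner), z ∈ X ∪ C (.node l r) → a ⟨z, h⟩ = b ⟨z, h⟩) →
      A.Agree a e ∧ A.Agree a c → A.Agree b e ∧ A.Agree b c := fun e a b hab ha =>
    ⟨ha.1.congr fun z hz hX => hab z hz (Finset.mem_union_left _ hX),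
      ha.2.congr fun z hz hX => hab z hz (Finset.mem_union_right _ hX)⟩
  -- Given C_l, the variables X_l separate from X_r and from C_r ∪ C_w; X_r is blocked because it
  -- lies in the complement of X_l.
  have s1 := mass_mul_mass hV val (hC.latent _ hl) hdisj
    (fun s hs t ht p hp => hC.covers _ hl s hs t (by
      obtain ⟨i, hi, rfl⟩ := ht
      exact ⟨i, by simpa using Finset.disjoint_right.mp hdisj hi, rfl⟩) p hp)
    (hC.blocks_left l r h) dl (hq dr)
  -- X_l is already gone, so C_r has to separate X_r only from C_l ∪ C_w, and the second set of
  -- observed variables is empty.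
  have s2 := mass_mul_mass hV val (hC.latent _ hr) (Finset.disjoint_empty_right r.vars)
    (fun s hs t ht p hp => by
      obtain ⟨i, hi, rfl⟩ := ht
      exact absurd hi (by simp))
    (hC.blocks_right l r h) dr (hq dl)
  rw [Finset.union_empty] at s2
  rw [← mass_congr e1, ← mass_congr e1] at s1
  rw [← mass_congr e2, ← mass_congr e2] at s2
  rw [mul_left_comm, s1, mul_left_comm, s2]

/-! ### Structure and density of the restructured circuit. -/

section Correctness

variable [Fintype ι] [∀ i, MeasurableSpace (E i)] {μ : ∀ i, MeasureTheory.Measure (E i)}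
  (hV : V.IsVtree) (hW : W.IsVtree) (hA : A.IsStructuredPC μ V) (hC : ValidLabelling V W C)
include hV hW hA hC

theorem isStructuredPC_restructure : (A.restructure V W C hC.root).IsStructuredPC μ W where
  isPC := isPC_restructure hV hA hC
  scope_root := (scope_vecNode hV hA hC W.mem_nodes_self _).trans hW.2
  alternating := by
    classical
    constructor
    · refine RNode.cases ?_ ?_ ?_
      · intro i h c hk
        obtain ⟨f, hf⟩ := exists_rkind_leaf hV hA hC h c
        exact absurd (hf.symm.trans hk) (by simp)
      · intro l r h c _ t ht
        obtain ⟨d, -, rfl⟩ := (mem_rchildren_vecNode h c t).mp ht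
        rfl
      · intro l r h d hk
        cases hk
    · have hvec : ∀ (z : VTree ι) (hz : z ∈ W.nodes) (c : A.Assign (C z)),
          A.rkind V W C (vecNode C hz c) ≠ .prod := by
        intro z hz c hk
        cases z with
        | leaf i =>
          obtain ⟨f, hf⟩ := exists_rkind_leaf hV hA hC hz c
          exact absurd (hf.symm.trans hk) (by simp)
        | node l r => cases hk
      refine RNode.cases (fun i h c hk => absurd hk (hvec _ h c))
        (fun l r h c hk => absurd hk (hvec _ h c)) fun l r h d _ t ht => ?_
      rcases (mem_rchildren_layerNode h d t).mp ht with rfl | rfl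
      · exact hvec _ _ _
      · exact hvec _ _ _
  binaryProducts := by
    classical
    refine RNode.cases ?_ ?_ ?_
    · intro i h c hk
      obtain ⟨f, hf⟩ := exists_rkind_leaf hV hA hC h c
      exact absurd (hf.symm.trans hk) (by simp)
    · intro l r h c hk
      cases hk
    · intro l r h d _
      refine (congrArg Finset.card (rchildren_layerNode h d)).trans ?_
      exact Finset.card_pair (vecNode_ne hW.1 h _ _)
  smooth := by
    refine RNode.cases ?_ ?_ ?_
    · intro i h c hk
      obtain ⟨f, hf⟩ := exists_rkind_leaf hV hA hC h c
      exact absurd (hf.symm.trans hk) (by simp)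
    · intro l r h c _ s hs t ht
      obtain ⟨d, -, rfl⟩ := (mem_rchildren_vecNode h c s).mp hs
      obtain ⟨e, -, rfl⟩ := (mem_rchildren_vecNode h c t).mp ht
      rw [scope_layerNode hV hA hC, scope_layerNode hV hA hC]
    · intro l r h d hk
      cases hk
  decomposable := by
    classical
    refine RNode.cases ?_ ?_ ?_
    · intro i h c hk
      obtain ⟨f, hf⟩ := exists_rkind_leaf hV hA hC h c
      exact absurd (hf.symm.trans hk) (by simp)
    · intro l r h c hk
      cases hk
    · intro l r h d _ s hs t ht hst
      rcases (mem_rchildren_layerNode h d s).mp hs with rfl | rfl <;>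
        rcases (mem_rchildren_layerNode h d t).mp ht with rfl | rfl
      · exact absurd rfl hst
      · rw [scope_vecNode hV hA hC, scope_vecNode hV hA hC]
        exact hW.1.disjoint h
      · rw [scope_vecNode hV hA hC, scope_vecNode hV hA hC]
        exact (hW.1.disjoint h).symm
      · exact absurd rfl hst
  respects := by
    classical
    refine RNode.cases ?_ ?_ ?_
    · intro i h c hk
      obtain ⟨f, hf⟩ := exists_rkind_leaf hV hA hC h c
      exact absurd (hf.symm.trans hk) (by simp)
    · intro l r h c hk
      cases hk
    · intro l r h d _
      refine ⟨l, r, h,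
        vecNode C (VTree.children_mem_nodes h).1 (A.restrict Finset.subset_union_left d),
        vecNode C (VTree.children_mem_nodes h).2 (A.restrict Finset.subset_union_right d),
        Finset.ext fun t => (mem_rchildren_layerNode h d t).trans ?_,
        scope_vecNode hV hA hC _ _, scope_vecNode hV hA hC _ _⟩
      exact (Finset.mem_insert.trans (or_congr_right Finset.mem_singleton)).symm

/-- The node built for `z` and `c` represents `p(X_z | C_z = c)`. -/
theorem mass_mul_eval (x : ∀ i, E i) {z : VTree ι} (hz : z ∈ W.nodes) (c : A.Assign (C z)) :
    A.latentProb V c c * (A.restructure V W C hC.root).eval x (vecNode C hz c) =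
      A.mass V (A.eval x) (fun a => A.Agree a c) z.vars := by
  classical
  induction z with
  | leaf i =>
    obtain ⟨f, hf⟩ := exists_rkind_leaf hV hA hC hz c
    have he : (A.restructure V W C hC.root).eval x (vecNode C hz c) =
        A.eval x (A.governor V c (.leaf i)) :=
      (eval_leaf (A := A.restructure V W C hC.root) (t := vecNode C hz c) hf x).trans
        (eval_leaf hf x).symm
    -- On the event C_z = c the parent of the leaf has a fixed value, so the leaf function is a
    -- constant that can be taken out of the sum.
    rw [he, latentProb_self_eq_mass (A.eval x), mass, mass, Finset.sum_mul]
    refine Finset.sum_congr rfl fun a _ => ?_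
    by_cases ha : A.Agree a c
    · rw [if_pos ha, if_pos ha, Finset.prod_empty, mul_one, VTree.vars, Finset.prod_singleton,
        governor_congr hV.1 (hC.latent _ hz) subset_rfl c a
          (VTree.leaf_mem_nodes (hV.2 ▸ Finset.mem_univ i))]
      intro p hp hpz
      have hpC := (hC.leaf i p).mpr ⟨hp, hpz⟩
      exact ⟨hpC, hp, (ha p hp hpC).symm⟩
    · rw [if_neg ha, if_neg ha, zero_mul]
  | node l r ihl ihr =>
    obtain ⟨hl, hr⟩ := VTree.children_mem_nodes hz
    -- On a null event both sides vanish, so the uniform weights play no role.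
    by_cases hc : A.latentProb V c c = 0
    · rw [hc, zero_mul]
      rw [latentProb_self_eq_mass (A.eval x)] at hc
      exact (mass_eq_zero hc (fun _ h => h) _).symm
    have he : (A.restructure V W C hC.root).eval x (vecNode C hz c) =
        ∑ d ∈ Finset.univ.filter (fun d : A.Assign (C l ∪ C r) => A.Agree c d),
          A.latentCond V c d *
            ((A.restructure V W C hC.root).eval x
                (vecNode C hl (A.restrict Finset.subset_union_left d)) *
              (A.restructure V W C hC.root).eval x
                (vecNode C hr (A.restrict Finset.subset_union_right d))) := by
      refine (eval_sum (A := A.restructure V W C hC.root) (t := vecNode C hz c) rfl x).trans ?_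
      refine (sum_rchildren_vecNode hz c _).trans (Finset.sum_congr rfl fun d _ => ?_)
      refine congrArg (A.latentCond V c d * ·) ?_
      refine (eval_prod (A := A.restructure V W C hC.root) (t := layerNode C hz d) rfl x).trans ?_
      refine (Finset.prod_congr (rchildren_layerNode hz d) fun _ _ => rfl).trans ?_
      exact Finset.prod_pair (vecNode_ne hW.1 hz _ _)
    rw [he, ← sum_mass_agree (hC.latent _ hz) (childLabel_subset hC hz), Finset.mul_sum]
    refine Finset.sum_congr rfl fun d _ => ?_
    rw [← mul_assoc, (latentProb_mul_latentCond c d).resolve_right hc]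
    rw [latentProb_eq_mass (A.eval x)]
    -- If p(c, d) = 0 both terms vanish. Otherwise p(d_l) and p(d_r) are nonzero and can be
    -- cancelled after the product identity for masses is applied.
    by_cases hd : A.mass V (A.eval x) (fun a => A.Agree a c ∧ A.Agree a d) ∅ = 0
    · rw [hd, zero_mul, mass_eq_zero hd fun _ h => h]
    have key := mass_agree_union hV hW hC hz (A.eval x) c d
    have il := ihl hl (A.restrict Finset.subset_union_left d)
    have ir := ihr hr (A.restrict Finset.subset_union_right d)
    rw [latentProb_self_eq_mass (A.eval x)] at il ir
    have hl0 : A.mass V (A.eval x)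
        (fun a => A.Agree a (A.restrict (Finset.subset_union_left (s₂ := C r)) d)) ∅ ≠ 0 :=
      fun h0 => hd (mass_eq_zero h0 (fun a ha => ((agree_union d).mp ha.2).1) _)
    have hr0 : A.mass V (A.eval x)
        (fun a => A.Agree a (A.restrict (Finset.subset_union_right (s₁ := C l)) d)) ∅ ≠ 0 :=
      fun h0 => hd (mass_eq_zero h0 (fun a ha => ((agree_union d).mp ha.2).2) _)
    refine mul_left_cancel₀ hl0 (mul_left_cancel₀ hr0 ?_)
    rw [VTree.vars, mul_left_comm _ _ (A.mass V (A.eval x) _ (l.vars ∪ r.vars)), key, ← il, ← ir]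
    ring

/-- At the root of `W` the label is empty, so the conditioning event is certain and has total
probability 1; the invariant then equates the root value with the sum that represents the density of
`A`. -/
theorem density_restructure (x : ∀ i, E i) :
    (A.restructure V W C hC.root).density x = A.density x := by
  have h := mass_mul_eval hV hW hA hC x W.mem_nodes_self
    fun z => absurd z.2 (Finset.eq_empty_iff_forall_notMem.mp hC.root z.1)
  have hag : ∀ (a : A.Assign V.inner) (c : A.Assign (C W)), A.Agree a c := fun a c z _ hz =>
    absurd hz (Finset.eq_empty_iff_forall_notMem.mp hC.root z)
  rw [latentProb_self_eq_mass (A.eval x)] at h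
  simp only [mass, hag, if_true, Finset.prod_empty, mul_one, hW.2] at h
  rw [hA.sum_latentJoint hV, hA.sum_latentJoint_mul_eval hV, one_mul] at h
  exact h

end Correctness

end Circuit

theorem mainTheorem1 :
    ∃ K : ℕ, ∀ (ι : Type u) [Fintype ι] [DecidableEq ι] (E : ι → Type v)
      [∀ i, MeasurableSpace (E i)] (μ : ∀ i, MeasureTheory.Measure (E i))
      (V W : VTree ι), V.IsVtree → W.IsVtree →
      ∀ A : Circuit.{u, v, w} ι E, A.IsStructuredPC μ V →
      ∀ (C : VTree ι → Finset (VTree ι)) (hC : ValidLabelling V W C),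
        (A.restructure V W C hC.root).IsStructuredPC μ W ∧
        (∀ x : ∀ i, E i, (A.restructure V W C hC.root).density x = A.density x) ∧
        (A.restructure V W C hC.root).hiddenSize W ≤
          K * A.hiddenSize V ^ childCardinality W C ∧
        (A.restructure V W C hC.root).size ≤
          K * (Fintype.card ι * A.hiddenSize V ^ labelCardinality W C) ∧
        labelCardinality W C ≤ 2 * childCardinality W C := by
  -- The size bound dictates 3; the hidden state bound holds with constant 1.
  refine ⟨3, fun ι _ _ E _ μ V W hV hW A hA C hC =>
    ⟨Circuit.isStructuredPC_restructure hV hW hA hC, Circuit.density_restructure hV hW hA hC, ?_,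
      Circuit.size_restructure_le hV hW hA hC, Circuit.labelCardinality_le hC⟩⟩
  exact (Circuit.hiddenSize_restructure_le hV hW hA hC).trans
    (Nat.le_mul_of_pos_left _ (by norm_num))
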